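/- Let $K>2$, $n\ge 1$, $d\ge K$, $L\ge 1$. For matrices $W_L\in\mathbb R^{K\times d}$, $W_{L-1},\dots,W_1\in\mathbb R^{d\times d}$, $H_1\in\mathbb R^{d\times Kn}$ put $Z=W_LW_{L-1}\cdots W_1H_1\in\mathbb R^{K\times Kn}$, with columns $z_{ic}$ ($c=1,\dots,K$, $i=1,\dots,n$) arranged in class order, and consider the max-margin problem $$\min_{W_L,\dots,W_1,H_1}\ \|H_1\|_F^2+\sum_{l=1}^L\|W_l\|_F^2\quad\text{s.t. } (z_{ic})_c-(z_{ic})_{c'}\ge 1\ \text{ for all } c'\neq c \text{ and all } i,$$ restricted to parameters whose logit matrix $Z$ satisfies NC1, i.e. $Z=\bar Z\otimes 1_n^T$ for some $\bar Z\in\mathbb R^{K\times K}$ (where $1_n\in\mathbb R^n$ is the all-ones vector), with $\bar Z$ symmetric positive semi-definite and with equal-norm features, i.e. $\bar Z=Y^TY$ for a matrix $Y$ whose columns all have the same Euclidean norm. Theorem. For every $K>2$ there are $\mu>0$ and $L_0$, depending only on $K$, such that for all $L\ge L_0$, all $n\ge1$ and all $d\ge K$ the following holds: a matrix $Z\in\mathbb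 R^{K\times Kn}$ is the logit matrix of a global optimum of this restricted problem if and only if $$Z=X^TX\otimes 1_n^T,\qquad X\in\mathbb R^{2\times K},$$ where the columns $x_1,\dots,x_K$ of $X$ are uniformly spaced on a circle of radius $\mu$ about the origin, i.e. for some $\alpha\in\mathbb R$ $$\{x_i: i=1,\dots,K\}=\Big\{\big(\mu\cos(\tfrac{2\pi i}{K}+\alpha),\ \mu\sin(\tfrac{2\pi i}{K}+\alpha)\big): i=1,\dots,K\Big\}.$$ In particular a global optimum exists. -/

import Mathlib

open scoped Matrix Kronecker

/-- The squared Frobenius norm of a real matrix. -/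
noncomputable def frobSq {m n : Type*} [Fintype m] [Fintype n] (A : Matrix m n ℝ) : ℝ :=
  ∑ i, ∑ j, A i j ^ 2

/-- Parameters of the deep (linear) unconstrained feature model with `K` classes, `n` samples per
class, width `d` and depth `L ≥ 1`: the matrices `W_L`, `W_{L-1}, …, W_1` and the feature matrix
`H_1`. The hidden matrix `W_{l+1}` is `hidden l`. The columns of `H_1` are indexed by pairs
(class `c`, sample `i`), that is, in class order. -/
structure UFMParams (K n d L : ℕ) where
  /-- the last layer `W_L` -/
  last : Matrix (Fin K) (Fin d) ℝ
  /-- the hidden layers, `hidden l = W_{l+1}` -/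
  hidden : Fin (L - 1) → Matrix (Fin d) (Fin d) ℝ
  /-- the features `H_1` -/
  feat : Matrix (Fin d) (Fin K × Fin n) ℝ

namespace UFMParams

variable {K n d L : ℕ}

/-- The logit matrix `Z = W_L W_{L-1} ⋯ W_1 H_1`. -/
noncomputable def logits (Θ : UFMParams K n d L) : Matrix (Fin K) (Fin K × Fin n) ℝ :=
  Θ.last * (List.ofFn Θ.hidden).reverse.prod * Θ.feat

/-- The objective `‖H_1‖_F² + ∑_{l=1}^L ‖W_l‖_F²`. -/
noncomputable def objective (Θ : UFMParams K n d L) : ℝ :=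
  frobSq Θ.feat + (∑ l, frobSq (Θ.hidden l) + frobSq Θ.last)

end UFMParams

/-- The max-margin constraints: `(z_{ic})_c - (z_{ic})_{c'} ≥ 1` for all `c' ≠ c` and all samples
`i`, where `z_{ic}` is the column of `Z` of index `(c, i)`. -/
def MarginFeasible {K n : ℕ} (Z : Matrix (Fin K) (Fin K × Fin n) ℝ) : Prop :=
  ∀ (c c' : Fin K) (i : Fin n), c' ≠ c → Z c (c, i) - Z c' (c, i) ≥ 1

/-- `Zbar ⊗ 1_nᵀ`: every column of `Zbar` is repeated `n` times, in class order. -/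
def repeatCols {K : ℕ} (n : ℕ) (Zbar : Matrix (Fin K) (Fin K) ℝ) :
    Matrix (Fin K) (Fin K × Fin n) ℝ :=
  Matrix.of fun c' ci => Zbar c' ci.1

/-- `repeatCols n Zbar` is the Kronecker product of `Zbar` with the all-ones row of length `n`. -/
theorem repeatCols_eq_kronecker {K : ℕ} (n : ℕ) (Zbar : Matrix (Fin K) (Fin K) ℝ) :
    repeatCols n Zbar =
      (Zbar ⊗ₖ (Matrix.of fun (_ : Unit) (_ : Fin n) => (1 : ℝ))).submatrix
        (fun c => (c, ())) id := by
  ext c ci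
  simp [repeatCols, Matrix.kroneckerMap_apply]

/-- Equal norm features: `Zbar = YᵀY` is the Gram matrix of vectors (the columns of `Y`) that all
have the same Euclidean norm. -/
def EqualNormFeatures {K : ℕ} (Zbar : Matrix (Fin K) (Fin K) ℝ) : Prop :=
  ∃ (m : ℕ) (Y : Matrix (Fin m) (Fin K) ℝ) (r : ℝ),
    Zbar = Yᵀ * Y ∧ ∀ c, ∑ k, Y k c ^ 2 = r ^ 2

/-- The class of logit matrices under consideration: NC1 (`Z = Zbar ⊗ 1_nᵀ`), positive
semi-definite, and with equal norm features. -/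
def AdmissibleLogits {K n : ℕ} (Z : Matrix (Fin K) (Fin K × Fin n) ℝ) : Prop :=
  ∃ Zbar : Matrix (Fin K) (Fin K) ℝ,
    Z = repeatCols n Zbar ∧ Zbar.PosSemidef ∧ EqualNormFeatures Zbar

/-- `Θ` is a globally optimal solution of the max-margin problem among the parameters whose logit
matrix is admissible. -/
def UFMParams.IsGlobalOptimum {K n d L : ℕ} (Θ : UFMParams K n d L) : Prop :=
  (MarginFeasible Θ.logits ∧ AdmissibleLogits Θ.logits) ∧
    ∀ Θ' : UFMParams K n d L, MarginFeasible Θ'.logits → AdmissibleLogits Θ'.logits →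
      Θ.objective ≤ Θ'.objective

/-- The columns of `X ∈ ℝ^{2 × K}` form, in some order, the set
`{(μ cos (2πi/K + α), μ sin (2πi/K + α)) : i}`. The index `i` runs over a full set of residues
modulo `K`. -/
def IsRegularPolygon {K : ℕ} (μ α : ℝ) (X : Matrix (Fin 2) (Fin K) ℝ) : Prop :=
  (Set.range fun c : Fin K => Xᵀ c) =
    Set.range fun i : Fin K =>
      ![μ * Real.cos (2 * Real.pi * (i : ℝ) / K + α),
        μ * Real.sin (2 * Real.pi * (i : ℝ) / K + α)]

/-! Write `p = 2/(L+1)`. For a fixed logit matrix, the smallest total Frobenius cost of factoring it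
into `L+1` layers is `L+1` times the sum of the `p`-th powers of its singular values, at least as a
lower bound (`UFMParams.sum_eigenvalues_rpow_le_objective`), which polygons attain
(`IsRegularPolygon.exists_params`). The bound comes from a cost-minimal factorisation: perturbing
neighbouring factors by `G` and `G⁻¹` shows they are balanced, so the product `P` satisfies `P Pᵀ =
M ^ (L+1)` with `M` positive semi-definite, and the trace of `M` measures the cost.

It remains to minimise `∑ λ_k ^ p` over Gram matrices of equal-norm, separated vectors as `p → 0`.
Such a sum tends to the rank, so three eigenvalues bounded away from zero are too expensive.
Otherwise the vectors are nearly planar, and by AM-GM the leading terms are governed by the product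
of the two top eigenvalues, a planar Gram determinant. `le_gram_det_of_separated` bounds it from
below; the regular polygon attains the bound at zero error. A small third eigenvalue `z` lowers this
product only by a factor `1 - O(z)`, while `z ^ p` exceeds `√z`, so the third eigenvalue never pays
(`eventually_le_rpow_sum`).

The Gram determinant is a sum of `sin²` of angle differences, that is, `K²` minus the squared
modulus of `∑ exp(2iθ_j)`, up to scale. Spreading each point over an arc of length `δ` and applying
the bathtub principle bounds that modulus (`sin_mul_sum_cos_le`), and a trigonometric inequality
turns this into a bound in which the radius cancels. Equality forces two equal eigenvalues and rank
two, hence the smallest circle carrying `K` separated points, where the points must be equally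
spaced. -/

/-! ### Chebyshev factorisation and trigonometric bounds -/

open Polynomial in
theorem Polynomial.Chebyshev.eval_U_real_eq_prod (n : ℕ) (x : ℝ) :
    (Chebyshev.U ℝ n).eval x =
      2 ^ n * ∏ k ∈ Finset.range n, (x - Real.cos ((k + 1) * Real.pi / (n + 1))) := by
  have hinj := (Finset.range n).nodup_map_iff_injOn.mp (Chebyshev.roots_U_real_nodup n)
  have hroots := Chebyshev.roots_U_real n
  have hcard : Multiset.card (Chebyshev.U ℝ n).roots = (Chebyshev.U ℝ n).natDegree := by
    rw [hroots, Finset.card_val, Finset.card_image_of_injOn hinj, Finset.card_range,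
      natDegree_eq_of_degree_eq_some (Chebyshev.degree_U_natCast ℝ n)]
  have h := C_leadingCoeff_mul_prod_multiset_X_sub_C hcard
  rw [hroots, Chebyshev.leadingCoeff_U_natCast] at h
  rw [← h, eval_mul, eval_C]
  congr 1
  rw [eval_multiset_prod, Multiset.map_map]
  simp only [Function.comp_def, eval_sub, eval_X, eval_C]
  exact Finset.prod_image (g := fun k : ℕ => Real.cos ((k + 1) * Real.pi / (n + 1)))
    (f := fun a => x - a) hinj

/-- The two extreme factors of the product formula for `sin (K s) / sin s` bound it from above. -/
theorem sin_nat_mul_le {K : ℕ} (hK : 2 < K) {s : ℝ} (hs : 0 < s) (hsK : s ≤ Real.pi / K) :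
    Real.sin (K * s) ≤ K * Real.sin s * (1 - Real.sin s ^ 2 / Real.sin (Real.pi / K) ^ 2) := by
  obtain ⟨m, rfl⟩ : ∃ m, K = m + 3 := ⟨K - 3, by omega⟩
  have hpi := Real.pi_pos
  set q : ℝ := Real.pi / (m + 3 : ℕ) with hq
  have hq' : ((m + 3 : ℕ) : ℝ) * q = Real.pi := by rw [hq]; field_simp
  have hq0 : 0 < q := by rw [hq]; positivity
  have hqpi : q ≤ Real.pi / 3 := by
    rw [hq]; apply div_le_div_of_nonneg_left hpi.le (by norm_num); push_cast
    linarith [(Nat.cast_nonneg m : (0:ℝ) ≤ m)]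
  have hsin : 0 < Real.sin s := Real.sin_pos_of_pos_of_lt_pi hs (by linarith)
  have hsinq : 0 < Real.sin q := Real.sin_pos_of_pos_of_lt_pi hq0 (by linarith)
  set c : ℕ → ℝ := fun k => Real.cos ((k + 1) * Real.pi / ((m + 2 : ℕ) + 1)) with hc
  have hcq : ∀ k : ℕ, c k = Real.cos ((k + 1) * q) := by
    intro k; simp only [hc, hq]; push_cast; congr 1; field_simp; ring
  -- The extreme roots are `±cos q`, so their factors multiply to `x² - cos² q`; the `m` middle ones
  -- are kept together.
  have hprod : ∀ x : ℝ, (Polynomial.Chebyshev.U ℝ ((m + 2 : ℕ) : ℤ)).eval x =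
      2 ^ (m + 2) * (∏ k ∈ Finset.range m, (x - c (k + 1))) * ((x - c 0) * (x - c (m + 1))) := by
    intro x
    rw [Polynomial.Chebyshev.eval_U_real_eq_prod, Finset.prod_range_succ, Finset.prod_range_succ']
    simp only [hc]; ring
  have hc0 : c 0 = Real.cos q := by rw [hcq]; simp
  have hcm : c (m + 1) = - Real.cos q := by
    rw [hcq, ← Real.cos_pi_sub]; congr 1; rw [← hq']; push_cast; ring
  have hmul : ∀ x : ℝ, (x - c 0) * (x - c (m + 1)) = x ^ 2 - Real.cos q ^ 2 := by
    intro x; rw [hc0, hcm]; ring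
  have hle : ∀ k ∈ Finset.range m, c (k + 1) ≤ Real.cos q := by
    intro k hk
    rw [hcq]
    have hk' : (k : ℝ) + 1 ≤ m := by exact_mod_cast Finset.mem_range.mp hk
    apply Real.cos_le_cos_of_nonneg_of_le_pi hq0.le
    · rw [← hq']; push_cast; nlinarith
    · push_cast; nlinarith
  have hcosq : Real.cos q ≤ Real.cos s :=
    Real.cos_le_cos_of_nonneg_of_le_pi hs.le (by linarith) hsK
  -- The middle factors are nonnegative at `cos s` and increase up to `x = 1`, where `U` takes the
  -- value `K`.
  have hmid : (∏ k ∈ Finset.range m, (Real.cos s - c (k + 1))) ≤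
      ∏ k ∈ Finset.range m, (1 - c (k + 1)) := by
    apply Finset.prod_le_prod
    · intro k hk; linarith [hle k hk]
    · intro k hk; linarith [Real.cos_le_one s]
  have h1 := hprod 1
  rw [Polynomial.Chebyshev.U_eval_one, hmul] at h1
  have hs1 := hprod (Real.cos s)
  have hU := Polynomial.Chebyshev.U_real_cos s ((m + 2 : ℕ) : ℤ)
  rw [hs1, hmul] at hU
  have e1 : (1 : ℝ) ^ 2 - Real.cos q ^ 2 = Real.sin q ^ 2 := by
    rw [Real.sin_sq]; ring
  have e2 : Real.cos s ^ 2 - Real.cos q ^ 2 = Real.sin q ^ 2 - Real.sin s ^ 2 := by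
    rw [Real.sin_sq, Real.sin_sq]; ring
  rw [e1] at h1
  rw [e2] at hU
  have hd : 0 ≤ Real.sin q ^ 2 - Real.sin s ^ 2 := by
    rw [← e2]
    have : 0 ≤ Real.cos q := Real.cos_nonneg_of_mem_Icc ⟨by linarith, by linarith⟩
    nlinarith
  have hK3 : (((m + 2 : ℕ) : ℤ) : ℝ) + 1 = ((m + 3 : ℕ) : ℝ) := by push_cast; ring
  rw [hK3] at hU h1
  rw [← hU, h1]
  set A := ∏ k ∈ Finset.range m, (Real.cos s - c (k + 1))
  set B := ∏ k ∈ Finset.range m, (1 - c (k + 1))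
  have : 2 ^ (m + 2) * B * Real.sin q ^ 2 * Real.sin s * (1 - Real.sin s ^ 2 / Real.sin q ^ 2) =
      2 ^ (m + 2) * B * (Real.sin q ^ 2 - Real.sin s ^ 2) * Real.sin s := by
    field_simp
  rw [this]
  gcongr

/-- With `v` the ratio of squared sines, squaring `sin_nat_mul_le` leaves `(1 - v)² ≤ cos² s (1 -
v²)`. This follows from `sin² s ≤ 3v/4`, which is where `K ≥ 3` enters. -/
theorem sin_nat_mul_sq_le {K : ℕ} (hK : 2 < K) {s : ℝ} (hs : 0 < s) (hsK : s ≤ Real.pi / K) :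
    (2 * Real.sin (K * s)) ^ 2 ≤ (K * Real.sin (2 * s)) ^ 2 *
      (1 - (Real.sin s ^ 2 / Real.sin (Real.pi / K) ^ 2) ^ 2) := by
  have h := sin_nat_mul_le hK hs hsK
  have hpi := Real.pi_pos
  have hK3 : (3 : ℝ) ≤ K := by exact_mod_cast hK
  have hqpi : Real.pi / K ≤ Real.pi / 3 :=
    div_le_div_of_nonneg_left hpi.le (by norm_num) hK3
  have hq0 : 0 < Real.pi / K := by positivity
  have hKs : K * s ≤ Real.pi := by
    rw [le_div_iff₀ (by positivity)] at hsK; linarith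
  have h0 : 0 ≤ Real.sin (K * s) := Real.sin_nonneg_of_nonneg_of_le_pi (by positivity) hKs
  have hsinq : 0 < Real.sin (Real.pi / K) :=
    Real.sin_pos_of_pos_of_lt_pi hq0 (by linarith)
  have hsin : 0 < Real.sin s := Real.sin_pos_of_pos_of_lt_pi hs (by linarith)
  have hle : Real.sin s ≤ Real.sin (Real.pi / K) :=
    Real.sin_le_sin_of_le_of_le_pi_div_two (by linarith) (by linarith) hsK
  have hq34 : Real.sin (Real.pi / K) ^ 2 ≤ 3 / 4 := by
    have h1 : Real.sin (Real.pi / K) ≤ Real.sin (Real.pi / 3) :=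
      Real.sin_le_sin_of_le_of_le_pi_div_two (by linarith) (by linarith) hqpi
    calc Real.sin (Real.pi / K) ^ 2 ≤ Real.sin (Real.pi / 3) ^ 2 := by gcongr
      _ = 3 / 4 := Real.sq_sin_pi_div_three
  set v := Real.sin s ^ 2 / Real.sin (Real.pi / K) ^ 2 with hv
  have hv0 : 0 ≤ v := by positivity
  have hv1 : v ≤ 1 := by
    rw [hv, div_le_one (by positivity)]; gcongr
  have hsv : Real.sin s ^ 2 = v * Real.sin (Real.pi / K) ^ 2 := by
    rw [hv]; field_simp
  have hs34 : Real.sin s ^ 2 ≤ 3 / 4 * v := by rw [hsv]; nlinarith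
  rw [Real.sin_two_mul]
  have hcos : Real.cos s ^ 2 = 1 - Real.sin s ^ 2 := by rw [Real.cos_sq']
  have key : (1 - v) ^ 2 ≤ Real.cos s ^ 2 * (1 - v ^ 2) := by
    rw [hcos]
    nlinarith [mul_nonneg hv0 (sub_nonneg.2 hv1), mul_nonneg (mul_nonneg hv0 hv0) (sub_nonneg.2 hv1),
      mul_nonneg (sub_nonneg.2 hv1) (sub_nonneg.2 hs34),
      mul_nonneg hv0 (mul_nonneg (sub_nonneg.2 hv1) (sub_nonneg.2 hs34))]
  calc (2 * Real.sin (K * s)) ^ 2 ≤ (2 * (K * Real.sin s * (1 - v))) ^ 2 := by gcongr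
    _ = (2 * K * Real.sin s) ^ 2 * (1 - v) ^ 2 := by ring
    _ ≤ (2 * K * Real.sin s) ^ 2 * (Real.cos s ^ 2 * (1 - v ^ 2)) := by gcongr
    _ = _ := by ring

/-! ### Separated points on the circle -/

/-- Sorting finitely many `δ`-separated reals. -/
theorem exists_perm_add_mul_le {K : ℕ} {θ : Fin K → ℝ} {δ : ℝ}
    (hsep : ∀ i j, i ≠ j → δ ≤ |θ i - θ j|) :
    ∃ σ : Equiv.Perm (Fin K), ∀ i j : Fin K, i ≤ j →
      θ (σ i) + ((j : ℝ) - (i : ℝ)) * δ ≤ θ (σ j) := by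
  refine ⟨Tuple.sort θ, ?_⟩
  have hmono : Monotone (θ ∘ Tuple.sort θ) := Tuple.monotone_sort θ
  set f := θ ∘ Tuple.sort θ with hf
  have hstep : ∀ i j : Fin K, i < j → f i + δ ≤ f j := by
    intro i j hij
    have h1 := hmono hij.le
    have h2 := hsep (Tuple.sort θ j) (Tuple.sort θ i) (by simpa using hij.ne')
    have h3 : |θ (Tuple.sort θ j) - θ (Tuple.sort θ i)| = f j - f i :=
      abs_of_nonneg (sub_nonneg.2 h1)
    linarith
  have hind : ∀ m : ℕ, ∀ i j : Fin K, (j : ℕ) = i + m → f i + m * δ ≤ f j := by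
    intro m
    induction m with
    | zero => intro i j h; simp [Fin.ext (show (j : ℕ) = i by simpa using h)]
    | succ m ih =>
      intro i j h
      have hj := j.2
      have h1 := ih i ⟨i + m, by omega⟩ rfl
      have h2 := hstep ⟨i + m, by omega⟩ j (by rw [Fin.lt_def]; simp; omega)
      push_cast; linarith
  intro i j hij
  have h := hind (j - i) i j (by have := Fin.le_def.1 hij; omega)
  rwa [Nat.cast_sub (Fin.le_def.1 hij)] at h

theorem integral_cos_two_mul_sub (a b t : ℝ) :
    ∫ x in a..b, (Real.cos (2 * x) - t) =
      (Real.sin (2 * b) - Real.sin (2 * a)) / 2 - (b - a) * t := by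
  rw [intervalIntegral.integral_sub (Continuous.intervalIntegrable (by fun_prop) _ _) (by simp),
    intervalIntegral.integral_comp_mul_left (fun x => Real.cos x) (by norm_num), integral_cos,
    intervalIntegral.integral_const, smul_eq_mul, smul_eq_mul]
  ring

/-- The integrand has period `π`, and on one period is positive only within distance `w` of the
centre; a full turn contains two such arcs. -/
theorem integral_posPart_cos_two_mul_sub {w : ℝ} (hw : 0 ≤ w) (hw' : w ≤ Real.pi / 2) (A : ℝ) :
    ∫ x in A..(A + 2 * Real.pi), max (Real.cos (2 * x) - Real.cos (2 * w)) 0 =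
      2 * (Real.sin (2 * w) - 2 * w * Real.cos (2 * w)) := by
  set g : ℝ → ℝ := fun x => max (Real.cos (2 * x) - Real.cos (2 * w)) 0 with hg
  have hpi := Real.pi_pos
  have hcont : Continuous g := by fun_prop
  have hint : ∀ a b, IntervalIntegrable g MeasureTheory.volume a b :=
    fun a b => hcont.intervalIntegrable a b
  have hper : Function.Periodic g Real.pi := by
    intro x
    simp only [hg, mul_add, Real.cos_add_two_pi]
  have h1 : ∀ B : ℝ, ∫ x in B..(B + Real.pi), g x = ∫ x in (-(Real.pi / 2))..(Real.pi / 2), g x := by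
    intro B
    rw [hper.intervalIntegral_add_eq B (-(Real.pi / 2))]
    congr 1; ring
  have hzero : ∀ a b : ℝ, a ≤ b → (∀ x ∈ Set.Icc a b, w ≤ |x| ∧ |x| ≤ Real.pi / 2) →
      ∫ x in a..b, g x = 0 := by
    intro a b hab h
    have : ∫ x in a..b, g x = ∫ x in a..b, (0 : ℝ) := by
      apply intervalIntegral.integral_congr
      intro x hx
      rw [Set.uIcc_of_le hab] at hx
      obtain ⟨h1, h2⟩ := h x hx
      have h3 : Real.cos (2 * x) = Real.cos (2 * |x|) := by
        rw [← Real.cos_abs (2 * x), abs_mul]; norm_num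
      simp only [hg]
      rw [max_eq_right]
      rw [h3, sub_nonpos]
      exact Real.cos_le_cos_of_nonneg_of_le_pi (by linarith) (by linarith) (by linarith)
    rw [this]; simp
  have hmid : ∫ x in (-w)..w, g x = ∫ x in (-w)..w, (Real.cos (2 * x) - Real.cos (2 * w)) := by
    apply intervalIntegral.integral_congr
    intro x hx
    rw [Set.uIcc_of_le (by linarith)] at hx
    have h3 : Real.cos (2 * x) = Real.cos (2 * |x|) := by
      rw [← Real.cos_abs (2 * x), abs_mul]; norm_num
    have h4 : |x| ≤ w := abs_le.2 hx
    simp only [hg]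
    rw [max_eq_left]
    rw [h3, sub_nonneg]
    exact Real.cos_le_cos_of_nonneg_of_le_pi (by positivity) (by linarith) (by linarith)
  have h2 : ∫ x in (-(Real.pi / 2))..(Real.pi / 2), g x =
      Real.sin (2 * w) - 2 * w * Real.cos (2 * w) := by
    rw [← intervalIntegral.integral_add_adjacent_intervals (hint _ w) (hint w _),
      ← intervalIntegral.integral_add_adjacent_intervals (hint _ (-w)) (hint (-w) w),
      hzero (-(Real.pi / 2)) (-w) (by linarith), hzero w (Real.pi / 2) hw', hmid,
      integral_cos_two_mul_sub, mul_neg, Real.sin_neg]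
    · ring
    · intro x hx
      rw [abs_of_nonneg (hw.trans hx.1)]; exact hx
    · intro x hx
      rw [abs_of_nonpos (by linarith [hx.2])]
      exact ⟨by linarith [hx.2], by linarith [hx.1]⟩
  calc ∫ x in A..(A + 2 * Real.pi), g x
      = (∫ x in A..(A + Real.pi), g x) + ∫ x in (A + Real.pi)..(A + Real.pi + Real.pi), g x := by
        rw [intervalIntegral.integral_add_adjacent_intervals (hint _ _) (hint _ _)]
        congr 1; ring
    _ = _ := by rw [h1, h1, h2]; ring

section Separated

variable {K : ℕ} {θ : Fin K → ℝ} {δ : ℝ}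

/-- After sorting, there are `K - 1` gaps of at least `δ`; `hsep'` supplies the last one, across the
cut of the circle. -/
theorem card_mul_le_two_pi (hK : 0 < K)
    (hsep : ∀ i j, i ≠ j → δ ≤ |θ i - θ j|) (hsep' : ∀ i j, |θ i - θ j| ≤ 2 * Real.pi - δ) :
    K * δ ≤ 2 * Real.pi := by
  obtain ⟨σ, hσ⟩ := exists_perm_add_mul_le hsep
  have h := hσ ⟨0, hK⟩ ⟨K - 1, by omega⟩ (by simp [Fin.le_def])
  have h2 := (le_abs_self _).trans (hsep' (σ ⟨K - 1, by omega⟩) (σ ⟨0, hK⟩))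
  have h3 : ((K - 1 : ℕ) : ℝ) = K - 1 := by rw [Nat.cast_sub (by omega)]; simp
  simp only [h3] at h
  push_cast at h
  linarith

/-- Separated points on the circle that fill it are equally spaced. -/
theorem exists_perm_eq_add_mul (hK : 0 < K)
    (hsep : ∀ i j, i ≠ j → δ ≤ |θ i - θ j|) (hsep' : ∀ i j, |θ i - θ j| ≤ 2 * Real.pi - δ)
    (hfull : K * δ = 2 * Real.pi) :
    ∃ (σ : Equiv.Perm (Fin K)) (α : ℝ), ∀ i, θ (σ i) = α + i * δ := by
  obtain ⟨σ, hσ⟩ := exists_perm_add_mul_le hsep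
  refine ⟨σ, θ (σ ⟨0, hK⟩), fun i => ?_⟩
  have h1 := hσ ⟨0, hK⟩ i (by simp [Fin.le_def])
  have h2 := hσ i ⟨K - 1, by omega⟩ (by rw [Fin.le_def]; simp; omega)
  have h4 := (le_abs_self _).trans (hsep' (σ ⟨K - 1, by omega⟩) (σ ⟨0, hK⟩))
  have h3 : ((K - 1 : ℕ) : ℝ) = K - 1 := by rw [Nat.cast_sub (by omega)]; simp
  simp only [h3] at h2
  push_cast at h1
  linarith

/-- Among separated points on the circle, two antipodal arcs maximise the alignment. -/
theorem sin_mul_sum_cos_le (hK : 0 < K) (hδ : 0 < δ)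
    (hsep : ∀ i j, i ≠ j → δ ≤ |θ i - θ j|) (hsep' : ∀ i j, |θ i - θ j| ≤ 2 * Real.pi - δ) :
    Real.sin δ * ∑ j, Real.cos (2 * θ j) ≤ 2 * Real.sin (K * δ / 2) := by
  have hpi := Real.pi_pos
  have hKδ := card_mul_le_two_pi hK hsep hsep'
  -- Two antipodal arcs of half-width `w` have total length `4w = Kδ`, the total length of the arcs
  -- around the points.
  set w : ℝ := K * δ / 4 with hw
  have hw0 : 0 ≤ w := by positivity
  have hw1 : w ≤ Real.pi / 2 := by linarith
  set t := Real.cos (2 * w) with ht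
  set g : ℝ → ℝ := fun x => max (Real.cos (2 * x) - t) 0 with hg
  have hcont : Continuous g := by fun_prop
  have : Nonempty (Fin K) := ⟨⟨0, hK⟩⟩
  obtain ⟨j₀, hj₀⟩ := Finite.exists_min θ
  set A := θ j₀ - δ / 2 with hA
  set I : Fin K → Set ℝ := fun j => Set.Ioc (θ j - δ / 2) (θ j + δ / 2) with hI
  have hIW : ∀ j, I j ⊆ Set.Ioc A (A + 2 * Real.pi) := by
    intro j
    have h1 := (le_abs_self _).trans (hsep' j j₀)
    have h2 := hj₀ j
    exact Set.Ioc_subset_Ioc (by linarith) (by linarith)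
  have hdisj : Pairwise (Function.onFun Disjoint I) := by
    intro i j hij
    rw [Function.onFun, Set.disjoint_left]
    rintro x ⟨h1, h2⟩ ⟨h3, h4⟩
    have h5 := hsep i j hij
    rcases le_abs.1 h5 with h | h <;> linarith
  have hon : ∀ a b, MeasureTheory.IntegrableOn g (Set.Ioc a b) := fun a b =>
    (hcont.integrableOn_Icc (a := a) (b := b)).mono_set Set.Ioc_subset_Icc_self
  have h1 : ∑ j, ∫ x in I j, g x = ∫ x in ⋃ j, I j, g x :=
    (MeasureTheory.integral_iUnion_fintype (fun j => measurableSet_Ioc) hdisj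
      (fun j => hon _ _)).symm
  have h2 : ∫ x in ⋃ j, I j, g x ≤ ∫ x in Set.Ioc A (A + 2 * Real.pi), g x :=
    MeasureTheory.setIntegral_mono_set (hon _ _)
      (Filter.Eventually.of_forall fun x => le_max_right _ _)
      (Set.iUnion_subset hIW).eventuallyLE
  rw [← intervalIntegral.integral_of_le (by linarith),
    integral_posPart_cos_two_mul_sub hw0 hw1] at h2
  -- Averaging over an arc of length `δ` multiplies the second harmonic by `sin δ / δ`; replacing
  -- the integrand by its positive part only increases it.
  have h3 : ∀ j, Real.sin δ * Real.cos (2 * θ j) - δ * t ≤ ∫ x in I j, g x := by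
    intro j
    have hab : θ j - δ / 2 ≤ θ j + δ / 2 := by linarith
    rw [← intervalIntegral.integral_of_le hab]
    have : Real.sin δ * Real.cos (2 * θ j) - δ * t =
        ∫ x in (θ j - δ / 2)..(θ j + δ / 2), (Real.cos (2 * x) - t) := by
      rw [integral_cos_two_mul_sub,
        show 2 * (θ j + δ / 2) = 2 * θ j + δ by ring, show 2 * (θ j - δ / 2) = 2 * θ j - δ by ring,
        Real.sin_add, Real.sin_sub]
      ring
    rw [this]
    exact intervalIntegral.integral_mono_on hab (Continuous.intervalIntegrable (by fun_prop) _ _)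
      (hcont.intervalIntegrable _ _) (fun x _ => le_max_left _ _)
  have h4 : ∑ j, (Real.sin δ * Real.cos (2 * θ j) - δ * t) ≤ ∑ j, ∫ x in I j, g x :=
    Finset.sum_le_sum fun j _ => h3 j
  rw [Finset.sum_sub_distrib, ← Finset.mul_sum, Finset.sum_const, Finset.card_univ,
    Fintype.card_fin, nsmul_eq_mul] at h4
  have h5 : 2 * w = K * δ / 2 := by rw [hw]; ring
  rw [h1] at h4
  rw [← h5]
  have h6 : K * (δ * t) = 4 * w * t := by rw [hw]; ring
  linarith

end Separated

theorem abs_mem_Icc_of_cos_le {x δ : ℝ} (hδ' : δ ≤ Real.pi) (hx : |x| ≤ 2 * Real.pi)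
    (h : Real.cos x ≤ Real.cos δ) : δ ≤ |x| ∧ |x| ≤ 2 * Real.pi - δ := by
  have hpi := Real.pi_pos
  rw [← Real.cos_abs x] at h
  constructor
  · by_contra! hlt
    exact absurd (Real.cos_lt_cos_of_nonneg_of_le_pi (abs_nonneg x) hδ' hlt) (not_lt.2 h)
  · by_contra! hlt
    have := Real.cos_lt_cos_of_nonneg_of_le_pi (x := 2 * Real.pi - |x|) (y := δ)
      (by linarith) hδ' (by linarith)
    rw [Real.cos_two_pi_sub] at this
    exact absurd this (not_lt.2 h)

theorem cos_two_pi_div_lt_one {K : ℕ} (hK : 2 < K) : Real.cos (2 * Real.pi / K) < 1 := by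
  have hpi := Real.pi_pos
  have hK3 : (3 : ℝ) ≤ K := by exact_mod_cast hK
  rw [← Real.cos_zero]
  apply Real.cos_lt_cos_of_nonneg_of_le_pi le_rfl
  · rw [div_le_iff₀ (by positivity)]; nlinarith
  · positivity

theorem one_sub_cos_eq_two_mul_sin_sq (x : ℝ) : 1 - Real.cos x = 2 * Real.sin (x / 2) ^ 2 := by
  rw [Real.sin_sq_eq_half_sub, show 2 * (x / 2) = x by ring]; ring

/-- The bathtub bound controls `|∑ exp(2iθ_j)|` through the minimal gap `δ = arccos (1 - κ)`, and
`sin_nat_mul_sq_le` with `s = δ/2` rewrites it in terms of `κ`. -/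
theorem sq_le_sub_sq_sum_cos {K : ℕ} (hK : 2 < K) {θ : Fin K → ℝ} {κ : ℝ} (hκ : 0 < κ)
    (hθ : ∀ i j, |θ i - θ j| ≤ 2 * Real.pi)
    (hsep : ∀ i j, i ≠ j → κ ≤ 1 - Real.cos (θ i - θ j)) :
    (K : ℝ) ^ 2 * (κ / (1 - Real.cos (2 * Real.pi / K))) ^ 2 ≤
      (K : ℝ) ^ 2 - ((∑ i, Real.cos (2 * θ i)) ^ 2 + (∑ i, Real.sin (2 * θ i)) ^ 2) := by
  have hpi := Real.pi_pos
  have hK3 : (3 : ℝ) ≤ K := by exact_mod_cast hK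
  have hκ2 : κ ≤ 2 := by
    have := hsep ⟨0, by omega⟩ ⟨1, by omega⟩ (by simp)
    linarith [Real.neg_one_le_cos (θ ⟨0, by omega⟩ - θ ⟨1, by omega⟩)]
  set δ := Real.arccos (1 - κ) with hδdef
  have hcosδ : Real.cos δ = 1 - κ := Real.cos_arccos (by linarith) (by linarith)
  have hδ0 : 0 < δ := Real.arccos_pos.2 (by linarith)
  have hδpi : δ ≤ Real.pi := Real.arccos_le_pi _
  have habs : ∀ i j, i ≠ j → δ ≤ |θ i - θ j| ∧ |θ i - θ j| ≤ 2 * Real.pi - δ := fun i j hij =>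
    abs_mem_Icc_of_cos_le hδpi (hθ i j) (by rw [hcosδ]; linarith [hsep i j hij])
  have habs' : ∀ i j, |θ i - θ j| ≤ 2 * Real.pi - δ := by
    intro i j
    rcases eq_or_ne i j with rfl | hij
    · simp; linarith
    · exact (habs i j hij).2
  have hKδ := card_mul_le_two_pi (by omega) (fun i j hij => (habs i j hij).1) habs'
  set A := ∑ i, Real.cos (2 * θ i) with hA
  set B := ∑ i, Real.sin (2 * θ i) with hB
  set φ := Complex.arg ⟨A, B⟩ with hφ
  set ρ : ℝ := ‖(⟨A, B⟩ : ℂ)‖ with hρ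
  have hAρ : ρ * Real.cos φ = A := Complex.norm_mul_cos_arg ⟨A, B⟩
  have hBρ : ρ * Real.sin φ = B := Complex.norm_mul_sin_arg ⟨A, B⟩
  have hρ2 : A ^ 2 + B ^ 2 = ρ ^ 2 := by
    rw [← hAρ, ← hBρ, mul_pow, mul_pow, ← mul_add, Real.cos_sq_add_sin_sq, mul_one]
  -- Rotating by `φ/2` makes the second harmonic sum real, so its cosine part is the full modulus
  -- `ρ`.
  have hbath := sin_mul_sum_cos_le (θ := fun i => θ i - φ / 2) (by omega) hδ0
    (fun i j hij => by simpa using (habs i j hij).1) (fun i j => by simpa using habs' i j)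
  have hsum : ∑ j, Real.cos (2 * (θ j - φ / 2)) = ρ := by
    have : ∀ j, Real.cos (2 * (θ j - φ / 2)) =
        Real.cos (2 * θ j) * Real.cos φ + Real.sin (2 * θ j) * Real.sin φ := by
      intro j
      rw [← Real.cos_sub]; congr 1; ring
    rw [Finset.sum_congr rfl fun j _ => this j, Finset.sum_add_distrib, ← Finset.sum_mul,
      ← Finset.sum_mul, ← hA, ← hB, ← hAρ, ← hBρ]
    linear_combination ρ * Real.cos_sq_add_sin_sq φ
  rw [hsum] at hbath
  have hs : δ / 2 ≤ Real.pi / K := by rw [le_div_iff₀ (by positivity)]; linarith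
  have htrig := sin_nat_mul_sq_le hK (s := δ / 2) (by positivity) hs
  have hsinδ : 0 < Real.sin δ := Real.sin_pos_of_pos_of_lt_pi hδ0 (by nlinarith)
  rw [show 2 * (δ / 2) = δ by ring, show (K : ℝ) * (δ / 2) = K * δ / 2 by ring] at htrig
  have hv : Real.sin (δ / 2) ^ 2 / Real.sin (Real.pi / K) ^ 2 =
      κ / (1 - Real.cos (2 * Real.pi / K)) := by
    have e1 := one_sub_cos_eq_two_mul_sin_sq δ
    have e2 := one_sub_cos_eq_two_mul_sin_sq (2 * Real.pi / K)
    rw [show 2 * Real.pi / K / 2 = Real.pi / K by ring] at e2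
    rw [e2, show κ = 2 * Real.sin (δ / 2) ^ 2 by rw [← e1, hcosδ]; ring,
      mul_div_mul_left _ _ two_ne_zero]
  rw [hv] at htrig
  set v := κ / (1 - Real.cos (2 * Real.pi / K))
  have h1 : (Real.sin δ * ρ) ^ 2 ≤ (2 * Real.sin (K * δ / 2)) ^ 2 := by
    have : 0 ≤ Real.sin δ * ρ := mul_nonneg hsinδ.le (norm_nonneg _)
    gcongr
  have h2 : Real.sin δ ^ 2 * ρ ^ 2 ≤ Real.sin δ ^ 2 * ((K : ℝ) ^ 2 * (1 - v ^ 2)) := by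
    calc _ = (Real.sin δ * ρ) ^ 2 := by ring
      _ ≤ _ := h1.trans htrig
      _ = _ := by ring
  have h3 := le_of_mul_le_mul_left h2 (by positivity)
  rw [hρ2]; linarith

/-! ### Planar Gram determinants and rigidity of the polygon -/

theorem exists_polar (a b : ℝ) : ∃ ρ θ : ℝ, 0 ≤ ρ ∧ a = ρ * Real.cos θ ∧ b = ρ * Real.sin θ ∧
    |θ| ≤ Real.pi :=
  ⟨‖(⟨a, b⟩ : ℂ)‖, Complex.arg ⟨a, b⟩, norm_nonneg _, (Complex.norm_mul_cos_arg ⟨a, b⟩).symm,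
    (Complex.norm_mul_sin_arg ⟨a, b⟩).symm, Complex.abs_arg_le_pi _⟩

/-- Lagrange's identity: it turns the Gram determinant into a sum of squared areas. -/
theorem sum_mul_sum_sub_sq {ι : Type*} [Fintype ι] (a b : ι → ℝ) :
    ∑ i, ∑ j, (a i * b j - b i * a j) ^ 2 =
      2 * ((∑ i, a i ^ 2) * (∑ i, b i ^ 2) - (∑ i, a i * b i) ^ 2) := by
  have : ∀ i j, (a i * b j - b i * a j) ^ 2 =
      a i ^ 2 * b j ^ 2 + b i ^ 2 * a j ^ 2 - 2 * ((a i * b i) * (a j * b j)) := by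
    intro i j; ring
  simp only [this, Finset.sum_sub_distrib, Finset.sum_add_distrib, ← Finset.mul_sum,
    ← Finset.sum_mul]
  ring

/-- Lower bound on the Gram determinant of almost equal-norm, almost separated planar points. -/
theorem le_gram_det_of_separated {K : ℕ} (hK : 2 < K) {a b : Fin K → ℝ} {R ε : ℝ}
    (hε1 : ε < 1 / 2) (hεR : ε ≤ R) (hR : 0 < R)
    (hlo : ∀ i, R - ε ≤ a i ^ 2 + b i ^ 2) (hhi : ∀ i, a i ^ 2 + b i ^ 2 ≤ R)
    (hsep : ∀ i j, i ≠ j → 2 - 2 * ε ≤ (a i - a j) ^ 2 + (b i - b j) ^ 2) :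
    (K : ℝ) ^ 2 / 4 * (R - ε) ^ 2 *
        ((1 - 3 / 2 * ε) / R / (1 - Real.cos (2 * Real.pi / K))) ^ 2 ≤
      (∑ i, a i ^ 2) * (∑ i, b i ^ 2) - (∑ i, a i * b i) ^ 2 := by
  choose ρ θ hρ ha hb hθ using fun i => exists_polar (a i) (b i)
  have hnorm : ∀ i, a i ^ 2 + b i ^ 2 = ρ i ^ 2 := by
    intro i
    rw [ha, hb, mul_pow, mul_pow, ← mul_add, Real.cos_sq_add_sin_sq, mul_one]
  simp only [hnorm] at hlo hhi
  -- The squared distance is `(ρ_i - ρ_j)² + 2ρ_iρ_j(1 - cos)`. The radial part costs at most `ε`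
  -- beyond the `2ε` already lost, and `ρ_iρ_j ≤ R`; halving gives `3/2`.
  have hsep' : ∀ i j, i ≠ j → (1 - 3 / 2 * ε) / R ≤ 1 - Real.cos (θ i - θ j) := by
    intro i j hij
    have h1 := hsep i j hij
    have h2 : (a i - a j) ^ 2 + (b i - b j) ^ 2 =
        (ρ i - ρ j) ^ 2 + 2 * (ρ i * ρ j) * (1 - Real.cos (θ i - θ j)) := by
      rw [ha i, ha j, hb i, hb j, Real.cos_sub]
      linear_combination ρ i ^ 2 * Real.cos_sq_add_sin_sq (θ i) +
        ρ j ^ 2 * Real.cos_sq_add_sin_sq (θ j)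
    have h3 : (ρ i - ρ j) ^ 2 ≤ ε := by
      have e1 := hlo i; have e2 := hlo j; have e3 := hhi i; have e4 := hhi j
      rcases le_total (ρ i) (ρ j) with h | h
      · nlinarith [mul_nonneg (hρ i) (sub_nonneg.2 h)]
      · nlinarith [mul_nonneg (hρ j) (sub_nonneg.2 h)]
    have h4 : ρ i * ρ j ≤ R := by
      nlinarith [hhi i, hhi j, sq_nonneg (ρ i - ρ j)]
    have h5 : 0 ≤ 1 - Real.cos (θ i - θ j) := sub_nonneg.2 (Real.cos_le_one _)
    rw [div_le_iff₀ hR]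
    nlinarith [mul_le_mul_of_nonneg_right h4 h5]
  have hmain := sq_le_sub_sq_sum_cos hK (div_pos (by linarith) hR)
    (fun i j => by
      have := abs_sub (θ i) (θ j)
      linarith [hθ i, hθ j]) hsep'
  have hdet := sum_mul_sum_sub_sq a b
  have hterm : ∀ i j, (R - ε) ^ 2 * Real.sin (θ i - θ j) ^ 2 ≤ (a i * b j - b i * a j) ^ 2 := by
    intro i j
    have : (a i * b j - b i * a j) ^ 2 = (ρ i ^ 2 * ρ j ^ 2) * Real.sin (θ i - θ j) ^ 2 := by
      rw [ha i, ha j, hb i, hb j, Real.sin_sub]; ring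
    rw [this, sq (R - ε)]
    have h0 : 0 ≤ R - ε := by linarith
    gcongr
    · exact hlo i
    · exact hlo j
  have hsum : ∑ i, ∑ j, Real.sin (θ i - θ j) ^ 2 = 1 / 2 *
      ((K : ℝ) ^ 2 - ((∑ i, Real.cos (2 * θ i)) ^ 2 + (∑ i, Real.sin (2 * θ i)) ^ 2)) := by
    have : ∀ i j, Real.sin (θ i - θ j) ^ 2 = 1 / 2 - 1 / 2 *
        (Real.cos (2 * θ i) * Real.cos (2 * θ j)) -
          1 / 2 * (Real.sin (2 * θ i) * Real.sin (2 * θ j)) := by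
      intro i j
      rw [Real.sin_sq_eq_half_sub, show 2 * (θ i - θ j) = 2 * θ i - 2 * θ j by ring, Real.cos_sub]
      ring
    simp only [this, Finset.sum_sub_distrib, ← Finset.mul_sum, ← Finset.sum_mul, Finset.sum_const,
      Finset.card_univ, Fintype.card_fin, nsmul_eq_mul]
    ring
  have hfin : (R - ε) ^ 2 * ∑ i, ∑ j, Real.sin (θ i - θ j) ^ 2 ≤
      ∑ i, ∑ j, (a i * b j - b i * a j) ^ 2 := by
    simp only [Finset.mul_sum]
    exact Finset.sum_le_sum fun i _ => Finset.sum_le_sum fun j _ => hterm i j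
  rw [hsum, hdet] at hfin
  have := mul_le_mul_of_nonneg_left hmain (sq_nonneg (R - ε))
  linarith

/-- Separated points on a circle of the smallest possible radius form a regular polygon. -/
theorem exists_isRegularPolygon_of_separated {K : ℕ} (hK : 2 < K) {X : Matrix (Fin 2) (Fin K) ℝ}
    {μ : ℝ} (hμ : 0 < μ) (hμ2 : μ ^ 2 * (1 - Real.cos (2 * Real.pi / K)) = 1)
    (hnorm : ∀ i, X 0 i ^ 2 + X 1 i ^ 2 = μ ^ 2)
    (hsep : ∀ i j, i ≠ j → 2 ≤ (X 0 i - X 0 j) ^ 2 + (X 1 i - X 1 j) ^ 2) :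
    ∃ α, IsRegularPolygon μ α X := by
  have hpi := Real.pi_pos
  have hK3 : (3 : ℝ) ≤ K := by exact_mod_cast hK
  choose ρ θ hρ ha hb hθ using fun i => exists_polar (X 0 i) (X 1 i)
  have hρμ : ∀ i, ρ i = μ := by
    intro i
    have h := hnorm i
    rw [ha, hb, mul_pow, mul_pow, ← mul_add, Real.cos_sq_add_sin_sq, mul_one] at h
    exact (pow_left_inj₀ (hρ i) hμ.le two_ne_zero).1 h
  simp only [hρμ] at ha hb
  have hcos : ∀ i j, i ≠ j → Real.cos (θ i - θ j) ≤ Real.cos (2 * Real.pi / K) := by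
    intro i j hij
    have h1 := hsep i j hij
    have h2 : (X 0 i - X 0 j) ^ 2 + (X 1 i - X 1 j) ^ 2 =
        2 * (μ ^ 2 * (1 - Real.cos (θ i - θ j))) := by
      rw [ha i, ha j, hb i, hb j, Real.cos_sub]
      linear_combination μ ^ 2 * Real.cos_sq_add_sin_sq (θ i) +
        μ ^ 2 * Real.cos_sq_add_sin_sq (θ j)
    have h3 : μ ^ 2 * (1 - Real.cos (2 * Real.pi / K)) ≤ μ ^ 2 * (1 - Real.cos (θ i - θ j)) := by
      linarith
    linarith [le_of_mul_le_mul_left h3 (by positivity)]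
  have hδpi : 2 * Real.pi / K ≤ Real.pi := by
    rw [div_le_iff₀ (by positivity)]; nlinarith
  have habs : ∀ i j, i ≠ j → 2 * Real.pi / K ≤ |θ i - θ j| ∧
      |θ i - θ j| ≤ 2 * Real.pi - 2 * Real.pi / K := fun i j hij =>
    abs_mem_Icc_of_cos_le hδpi
      (by have := abs_sub (θ i) (θ j); linarith [hθ i, hθ j]) (hcos i j hij)
  obtain ⟨σ, α, hσ⟩ := exists_perm_eq_add_mul (by omega) (fun i j hij => (habs i j hij).1)
    (fun i j => by
      rcases eq_or_ne i j with rfl | hij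
      · simp; linarith
      · exact (habs i j hij).2) (by field_simp)
  refine ⟨α, ?_⟩
  rw [IsRegularPolygon, ← σ.surjective.range_comp (fun c : Fin K => Xᵀ c)]
  congr 1
  ext i k
  have harg : 2 * Real.pi * (i : ℝ) / K + α = θ (σ i) := by rw [hσ]; ring
  simp only [Function.comp_apply, Matrix.transpose_apply, harg]
  fin_cases k
  · simpa using ha (σ i)
  · simpa using hb (σ i)

/-! ### Eigenvalue sums at small exponents -/

theorem Matrix.PosSemidef.exists_orthogonal_diagonal {σ : Type*} [Fintype σ] [DecidableEq σ]
    {A : Matrix σ σ ℝ} (hA : A.PosSemidef) :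
    ∃ (V : Matrix σ σ ℝ) (lam : σ → ℝ), (∀ k, 0 ≤ lam k) ∧ Vᵀ * V = 1 ∧ V * Vᵀ = 1 ∧
      A = V * Matrix.diagonal lam * Vᵀ := by
  refine ⟨hA.1.eigenvectorUnitary, hA.1.eigenvalues, hA.eigenvalues_nonneg, ?_, ?_, ?_⟩
  · exact Unitary.coe_star_mul_self hA.1.eigenvectorUnitary
  · exact Unitary.coe_mul_star_self hA.1.eigenvectorUnitary
  · have h := hA.1.spectral_theorem
    rw [Unitary.conjStarAlgAut_apply] at h
    exact h

/-- Here `x, y, z` stand for the three largest eigenvalues. If `z` is bounded below, three powers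
near `1` beat two; if `z` is small, `z ^ p` outweighs the linear loss in `xy`. -/
theorem eventually_le_rpow_sum {C : ℝ} (hC : 0 < C) :
    ∀ᶠ p in nhdsWithin (0 : ℝ) (Set.Ioi 0), ∀ x y z : ℝ, 0 ≤ z → z ≤ x → z ≤ y →
      (z < 1 / 2 → C ^ 2 * (1 - 7 * z) ≤ x * y) →
      2 * C ^ p ≤ x ^ p + y ^ p + z ^ p ∧
        (2 * C ^ p = x ^ p + y ^ p + z ^ p → x = C ∧ y = C ∧ z = 0) := by
  set B := max 1 C with hB
  have hB1 : 1 ≤ B := le_max_left _ _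
  have hBC : C ≤ B := le_max_right _ _
  -- For `z < e` one has `14B√z < 1`, so `√z` beats the loss `14 C ^ p z`, twice the factor `7` in
  -- the hypothesis.
  set e : ℝ := 1 / (14 * B) ^ 2 with he
  have he0 : 0 < e := by positivity
  have he1 : e ≤ 1 / 196 := by
    rw [he]; apply one_div_le_one_div_of_le (by norm_num); nlinarith
  have hlim : Filter.Tendsto (fun p : ℝ => (B / e) ^ p) (nhdsWithin 0 (Set.Ioi 0)) (nhds 1) := by
    have : ContinuousAt (fun p : ℝ => (B / e) ^ p) 0 :=
      Real.continuousAt_const_rpow (by positivity)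
    have h2 := this.tendsto.mono_left (nhdsWithin_le_nhds (s := Set.Ioi (0 : ℝ)))
    simpa using h2
  have hlt : ∀ᶠ p in nhdsWithin (0 : ℝ) (Set.Ioi 0), (B / e) ^ p < 3 / 2 :=
    hlim.eventually (gt_mem_nhds (by norm_num))
  have hhalf : ∀ᶠ p in nhdsWithin (0 : ℝ) (Set.Ioi 0), p < 1 / 2 :=
    nhdsWithin_le_nhds (gt_mem_nhds (by norm_num))
  filter_upwards [hlt, hhalf, self_mem_nhdsWithin] with p hp hp2 hp0 x y z hz hzx hzy hxy
  have hp0 : 0 < p := hp0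
  have hCp : 0 < C ^ p := Real.rpow_pos_of_pos hC p
  have hx : 0 ≤ x := hz.trans hzx
  have hy : 0 ≤ y := hz.trans hzy
  rcases le_or_gt e z with hez | hez
  · have h1 : 2 * C ^ p < x ^ p + y ^ p + z ^ p := by
      have h2 : e ^ p ≤ z ^ p := Real.rpow_le_rpow he0.le hez hp0.le
      have h3 : e ^ p ≤ x ^ p := Real.rpow_le_rpow he0.le (hez.trans hzx) hp0.le
      have h4 : e ^ p ≤ y ^ p := Real.rpow_le_rpow he0.le (hez.trans hzy) hp0.le
      have h5 : C ^ p ≤ B ^ p := Real.rpow_le_rpow hC.le hBC hp0.le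
      rw [Real.div_rpow (by positivity) he0.le, div_lt_iff₀ (Real.rpow_pos_of_pos he0 p)] at hp
      linarith
    exact ⟨h1.le, fun h => absurd h h1.ne⟩
  · have hxy' := hxy (by linarith)
    have hz1 : 0 ≤ 1 - 7 * z := by linarith
    -- AM-GM with its exact remainder, which also settles the equality case.
    have hamgm : x ^ p + y ^ p = 2 * (x * y) ^ (p / 2) + (x ^ (p / 2) - y ^ (p / 2)) ^ 2 := by
      have hsq : ∀ u : ℝ, 0 ≤ u → u ^ p = (u ^ (p / 2)) ^ 2 := by
        intro u hu
        rw [← Real.rpow_natCast, ← Real.rpow_mul hu]; congr 1; push_cast; ring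
      rw [hsq x hx, hsq y hy, Real.mul_rpow hx hy]; ring
    have hlow : C ^ p * (1 - 7 * z) ≤ (x * y) ^ (p / 2) := by
      have h1 : (C ^ 2 * (1 - 7 * z)) ^ (p / 2) ≤ (x * y) ^ (p / 2) :=
        Real.rpow_le_rpow (by positivity) hxy' (by positivity)
      rw [Real.mul_rpow (by positivity) hz1, ← Real.rpow_natCast, ← Real.rpow_mul hC.le] at h1
      have h2 : 1 - 7 * z ≤ (1 - 7 * z) ^ (p / 2) := by
        rcases hz1.eq_or_lt with h | h
        · rw [← h]; exact Real.rpow_nonneg le_rfl _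
        · calc 1 - 7 * z = (1 - 7 * z) ^ (1 : ℝ) := (Real.rpow_one _).symm
            _ ≤ _ := Real.rpow_le_rpow_of_exponent_ge h (by linarith) (by linarith)
      rw [show ((2 : ℕ) : ℝ) * (p / 2) = p by push_cast; ring] at h1
      exact (mul_le_mul_of_nonneg_left h2 hCp.le).trans h1
    rcases hz.eq_or_lt with hz0 | hz0
    · rw [← hz0, Real.zero_rpow hp0.ne', hamgm]
      rw [← hz0] at hlow
      constructor
      · nlinarith [sq_nonneg (x ^ (p / 2) - y ^ (p / 2))]
      · intro h
        have h1 : (x ^ (p / 2) - y ^ (p / 2)) ^ 2 = 0 :=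
          le_antisymm (by linarith) (sq_nonneg _)
        have h2 : x ^ (p / 2) = y ^ (p / 2) := sub_eq_zero.1 (pow_eq_zero_iff two_ne_zero |>.1 h1)
        have h3 : x = y := (Real.rpow_left_inj hx hy (by positivity)).1 h2
        subst h3
        have h4 : x ^ p = C ^ p := by
          rw [← hamgm] at *; linarith
        have h5 := (Real.rpow_left_inj hx hC.le hp0.ne').1 h4
        exact ⟨h5, h5, rfl⟩
    · have h1 : 14 * C ^ p * z < z ^ p := by
        have h2 : C ^ p ≤ B := by
          calc C ^ p ≤ B ^ p := Real.rpow_le_rpow hC.le hBC hp0.le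
            _ ≤ B ^ (1 : ℝ) := Real.rpow_le_rpow_of_exponent_le hB1 (by linarith)
            _ = B := Real.rpow_one B
        have h3 : Real.sqrt z ≤ z ^ p := by
          rw [Real.sqrt_eq_rpow]
          exact Real.rpow_le_rpow_of_exponent_ge hz0 (by linarith) hp2.le
        have h4 : Real.sqrt z * (14 * B) < 1 := by
          have : Real.sqrt z < 1 / (14 * B) := by
            rw [Real.sqrt_lt' (by positivity), div_pow, one_pow]; exact hez
          rwa [lt_div_iff₀ (by positivity)] at this
        have h5 : 0 < Real.sqrt z := Real.sqrt_pos.2 hz0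
        calc 14 * C ^ p * z ≤ 14 * B * z := by gcongr
          _ = Real.sqrt z * (14 * B) * Real.sqrt z := by
            nth_rewrite 1 [← Real.mul_self_sqrt hz]; ring
          _ < 1 * Real.sqrt z := by gcongr
          _ ≤ z ^ p := by rw [one_mul]; exact h3
      have h2 : 2 * C ^ p < x ^ p + y ^ p + z ^ p := by
        rw [hamgm]
        nlinarith [sq_nonneg (x ^ (p / 2) - y ^ (p / 2))]
      exact ⟨h2.le, fun h => absurd h h2.ne⟩

/-- The radius of the regular `K`-gon with side length `√2`. -/
noncomputable def polygonRadius (K : ℕ) : ℝ :=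
  1 / Real.sqrt (1 - Real.cos (2 * Real.pi / K))

theorem polygonRadius_pos {K : ℕ} (hK : 2 < K) : 0 < polygonRadius K :=
  one_div_pos.2 (Real.sqrt_pos.2 (sub_pos.2 (cos_two_pi_div_lt_one hK)))

theorem polygonRadius_sq {K : ℕ} (hK : 2 < K) :
    polygonRadius K ^ 2 = 1 / (1 - Real.cos (2 * Real.pi / K)) := by
  rw [polygonRadius, div_pow, one_pow,
    Real.sq_sqrt (sub_pos.2 (cos_two_pi_div_lt_one hK)).le]

theorem polygonRadius_sq_mul {K : ℕ} (hK : 2 < K) :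
    polygonRadius K ^ 2 * (1 - Real.cos (2 * Real.pi / K)) = 1 := by
  rw [polygonRadius_sq hK, one_div_mul_cancel (sub_pos.2 (cos_two_pi_div_lt_one hK)).ne']

theorem mul_diagonal_mul_transpose_apply {σ : Type*} [Fintype σ] [DecidableEq σ]
    (V : Matrix σ σ ℝ) (lam : σ → ℝ) (i j : σ) :
    (V * Matrix.diagonal lam * Vᵀ) i j = ∑ k, lam k * (V i k * V j k) := by
  rw [Matrix.mul_apply]
  refine Finset.sum_congr rfl fun k _ => ?_
  rw [Matrix.mul_diagonal, Matrix.transpose_apply]; ring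

theorem Finset.sum_eq_add_add_sum_erase {ι : Type*} [Fintype ι] [DecidableEq ι] {a b : ι}
    (hab : a ≠ b) (f : ι → ℝ) :
    ∑ k, f k = f a + (f b + ∑ k ∈ (Finset.univ.erase a).erase b, f k) := by
  rw [Finset.add_sum_erase _ _ (by simp [hab.symm]), Finset.add_sum_erase _ _ (by simp)]

section Spectral

variable {K : ℕ} {Z V : Matrix (Fin K) (Fin K) ℝ} {lam : Fin K → ℝ} {R : ℝ}

/-- Positivity of the quadratic form at `e_i + e_j` gives `Z i j ≥ -R`, while the margin gives `Z i
j ≤ R - 1`. -/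
theorem half_le_of_margin (hK : 2 < K) (hZ : Z = V * Matrix.diagonal lam * Vᵀ)
    (hlam : ∀ k, 0 ≤ lam k) (hdiag : ∀ i, Z i i = R) (hmargin : ∀ i j, i ≠ j → 1 ≤ R - Z i j) :
    1 / 2 ≤ R := by
  have hent : ∀ i j, Z i j = ∑ k, lam k * (V i k * V j k) := fun i j => by
    rw [hZ, mul_diagonal_mul_transpose_apply]
  set i : Fin K := ⟨0, by omega⟩
  set j : Fin K := ⟨1, by omega⟩
  have hij : i ≠ j := by simp [i, j]
  have h1 := hmargin i j hij
  have h2 : Z i i + Z j j + 2 * Z i j = ∑ k, lam k * (V i k + V j k) ^ 2 := by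
    rw [hent, hent, hent, Finset.mul_sum, ← Finset.sum_add_distrib, ← Finset.sum_add_distrib]
    exact Finset.sum_congr rfl fun k _ => by ring
  have h3 : 0 ≤ ∑ k, lam k * (V i k + V j k) ^ 2 :=
    Finset.sum_nonneg fun k _ => mul_nonneg (hlam k) (sq_nonneg _)
  rw [hdiag, hdiag] at h2
  linarith

/-- Projecting the Gram vectors to the two chosen eigendirections gives planar points whose Gram
matrix is diagonal with entries `lam a`, `lam b`. The discarded directions change squared norms by
at most `ε` and squared distances by at most `2ε`. -/
theorem top_eigenvalues_mul_ge (hK : 2 < K) (hV : Vᵀ * V = 1) (hV' : V * Vᵀ = 1)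
    (hZ : Z = V * Matrix.diagonal lam * Vᵀ)
    (hlam : ∀ k, 0 ≤ lam k) (hdiag : ∀ i, Z i i = R) (hmargin : ∀ i j, i ≠ j → 1 ≤ R - Z i j)
    {a b : Fin K} (hab : a ≠ b) {ε : ℝ} (hε : 0 ≤ ε) (hε1 : ε < 1 / 2)
    (hle : ∀ k, k ≠ a → k ≠ b → lam k ≤ ε) :
    (K * polygonRadius K ^ 2 / 2) ^ 2 * (1 - 7 * ε) ≤ lam a * lam b := by
  have hR := half_le_of_margin hK hZ hlam hdiag hmargin
  have hent : ∀ i j, Z i j = ∑ k, lam k * (V i k * V j k) := fun i j => by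
    rw [hZ, mul_diagonal_mul_transpose_apply]
  have hrow : ∀ i j, ∑ k, V i k * V j k = (1 : Matrix (Fin K) (Fin K) ℝ) i j := by
    intro i j; rw [← hV', Matrix.mul_apply]; rfl
  have hcol : ∀ k l, ∑ i, V i k * V i l = (1 : Matrix (Fin K) (Fin K) ℝ) k l := by
    intro i j; rw [← hV, Matrix.mul_apply]; rfl
  set T := (Finset.univ.erase a).erase b with hT
  have hT' : ∀ k ∈ T, lam k ≤ ε := by
    intro k hk
    rw [hT, Finset.mem_erase, Finset.mem_erase] at hk
    exact hle k hk.2.1 hk.1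
  have hrest : ∀ f : Fin K → ℝ, 0 ≤ ∑ k ∈ T, lam k * f k ^ 2 ∧
      ∑ k ∈ T, lam k * f k ^ 2 ≤ ε * ∑ k, f k ^ 2 := by
    intro f
    refine ⟨Finset.sum_nonneg fun k _ => mul_nonneg (hlam k) (sq_nonneg _), ?_⟩
    calc ∑ k ∈ T, lam k * f k ^ 2 ≤ ∑ k ∈ T, ε * f k ^ 2 :=
          Finset.sum_le_sum fun k hk => mul_le_mul_of_nonneg_right (hT' k hk) (sq_nonneg _)
      _ ≤ ∑ k, ε * f k ^ 2 := Finset.sum_le_sum_of_subset_of_nonneg (Finset.subset_univ _)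
          fun k _ _ => mul_nonneg hε (sq_nonneg _)
      _ = _ := by rw [Finset.mul_sum]
  set x : Fin K → ℝ := fun i => Real.sqrt (lam a) * V i a with hx
  set y : Fin K → ℝ := fun i => Real.sqrt (lam b) * V i b with hy
  have hnorm : ∀ i, R = x i ^ 2 + y i ^ 2 + ∑ k ∈ T, lam k * V i k ^ 2 := by
    intro i
    rw [← hdiag i, hent, Finset.sum_eq_add_add_sum_erase hab, ← hT]
    simp only [hx, hy, ← sq]
    rw [mul_pow, mul_pow, Real.sq_sqrt (hlam a), Real.sq_sqrt (hlam b)]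
    ring
  have hone : ∀ i, ∑ k, V i k ^ 2 = 1 := by
    intro i; have := hrow i i; simp only [← sq, Matrix.one_apply_eq] at this; exact this
  have hdist : ∀ i j, i ≠ j → 2 * R - 2 * Z i j =
      (x i - x j) ^ 2 + (y i - y j) ^ 2 + ∑ k ∈ T, lam k * (V i k - V j k) ^ 2 := by
    intro i j hij
    have h1 : 2 * R - 2 * Z i j = ∑ k, lam k * (V i k - V j k) ^ 2 := by
      have : 2 * R - 2 * Z i j = Z i i + Z j j - 2 * Z i j := by rw [hdiag, hdiag]; ring
      rw [this, hent, hent, hent, Finset.mul_sum, ← Finset.sum_add_distrib,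
        ← Finset.sum_sub_distrib]
      exact Finset.sum_congr rfl fun k _ => by ring
    rw [h1, Finset.sum_eq_add_add_sum_erase hab, ← hT]
    simp only [hx, hy, ← mul_sub]
    rw [mul_pow, mul_pow, Real.sq_sqrt (hlam a), Real.sq_sqrt (hlam b)]
    ring
  have htwo : ∀ i j, i ≠ j → ∑ k, (V i k - V j k) ^ 2 = 2 := by
    intro i j hij
    have : ∀ k, (V i k - V j k) ^ 2 = V i k ^ 2 + V j k ^ 2 - 2 * (V i k * V j k) := by
      intro k; ring
    simp only [this, Finset.sum_sub_distrib, Finset.sum_add_distrib, ← Finset.mul_sum, hone, hrow,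
      Matrix.one_apply_ne hij]
    norm_num
  have hmain := le_gram_det_of_separated hK (a := x) (b := y) (R := R) (ε := ε) hε1
    (by linarith) (by linarith)
    (fun i => by
      have h1 := hnorm i
      have h2 := (hrest (V i)).2
      rw [hone] at h2; linarith)
    (fun i => by linarith [hnorm i, (hrest (V i)).1])
    (fun i j hij => by
      have h1 := hdist i j hij
      have h2 := (hrest (fun k => V i k - V j k)).2
      simp only [htwo i j hij] at h2
      linarith [hmargin i j hij])
  have hxx : ∑ i, x i ^ 2 = lam a := by
    have := hcol a a
    simp only [hx, mul_pow, ← Finset.mul_sum, Real.sq_sqrt (hlam a)]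
    simp only [← sq, Matrix.one_apply_eq] at this
    rw [this, mul_one]
  have hyy : ∑ i, y i ^ 2 = lam b := by
    have := hcol b b
    simp only [hy, mul_pow, ← Finset.mul_sum, Real.sq_sqrt (hlam b)]
    simp only [← sq, Matrix.one_apply_eq] at this
    rw [this, mul_one]
  have hxy : ∑ i, x i * y i = 0 := by
    have h1 : ∀ i, x i * y i = Real.sqrt (lam a) * Real.sqrt (lam b) * (V i a * V i b) := by
      intro i; simp only [hx, hy]; ring
    simp only [h1, ← Finset.mul_sum, hcol, Matrix.one_apply_ne hab, mul_zero]
  rw [hxx, hyy, hxy] at hmain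
  have hμ := polygonRadius_sq hK
  refine le_trans ?_ (hmain.trans (by linarith))
  have hRpos : 0 < R := by linarith
  -- The unknown radius survives only through `ε / R`, which `R ≥ 1/2` bounds by `2ε`.
  have heq : (K : ℝ) ^ 2 / 4 * (R - ε) ^ 2 *
        ((1 - 3 / 2 * ε) / R / (1 - Real.cos (2 * Real.pi / K))) ^ 2 =
      (K * polygonRadius K ^ 2 / 2) ^ 2 * ((1 - ε / R) * (1 - 3 / 2 * ε)) ^ 2 := by
    rw [hμ]
    have : 1 - ε / R = (R - ε) / R := by field_simp
    rw [this]; ring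
  rw [heq]
  apply mul_le_mul_of_nonneg_left _ (sq_nonneg _)
  have h1 : ε / R ≤ 2 * ε := by
    rw [div_le_iff₀ hRpos]; nlinarith
  have h2 : 1 - 7 / 2 * ε ≤ (1 - ε / R) * (1 - 3 / 2 * ε) := by
    have h3 : (1 - 2 * ε) * (1 - 3 / 2 * ε) ≤ (1 - ε / R) * (1 - 3 / 2 * ε) :=
      mul_le_mul_of_nonneg_right (by linarith) (by linarith)
    nlinarith
  -- From `u ≥ 1 - 7ε/2`, `u² ≥ 2u - 1 ≥ 1 - 7ε`.
  nlinarith [sq_nonneg ((1 - ε / R) * (1 - 3 / 2 * ε) - 1)]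

/-- The two scaled eigenvectors are the rows of `X`. The trace then forces `R = polygonRadius K ^
2`, the radius at which separation leaves no slack. -/
theorem exists_isRegularPolygon_of_eigenvalues (hK : 2 < K) (hV : Vᵀ * V = 1)
    (hZ : Z = V * Matrix.diagonal lam * Vᵀ)
    (hdiag : ∀ i, Z i i = R) (hmargin : ∀ i j, i ≠ j → 1 ≤ R - Z i j)
    {a b : Fin K} (hab : a ≠ b) (ha : lam a = K * polygonRadius K ^ 2 / 2)
    (hb : lam b = K * polygonRadius K ^ 2 / 2) (h0 : ∀ k, k ≠ a → k ≠ b → lam k = 0) :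
    ∃ (X : Matrix (Fin 2) (Fin K) ℝ) (α : ℝ),
      IsRegularPolygon (polygonRadius K) α X ∧ Z = Xᵀ * X := by
  have hKpos : (0 : ℝ) < K := by exact_mod_cast (by omega : 0 < K)
  have hent : ∀ i j, Z i j = ∑ k, lam k * (V i k * V j k) := fun i j => by
    rw [hZ, mul_diagonal_mul_transpose_apply]
  have hcol : ∀ k, ∑ i, V i k ^ 2 = 1 := by
    intro k
    have : ∑ i, V i k * V i k = (1 : Matrix (Fin K) (Fin K) ℝ) k k := by
      rw [← hV, Matrix.mul_apply]; rfl
    simpa [sq] using this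
  set C : ℝ := K * polygonRadius K ^ 2 / 2 with hC
  have hC0 : 0 ≤ C := by positivity
  set X : Matrix (Fin 2) (Fin K) ℝ :=
    Matrix.of ![fun i => Real.sqrt C * V i a, fun i => Real.sqrt C * V i b] with hX
  have hXZ : Z = Xᵀ * X := by
    ext i j
    rw [hent, Finset.sum_eq_add_add_sum_erase hab, Finset.sum_eq_zero (s := (Finset.univ.erase a).erase b), ha, hb, Matrix.mul_apply, Fin.sum_univ_two]
    · simp only [hX, Matrix.transpose_apply, Matrix.of_apply, Matrix.cons_val_zero,
        Matrix.cons_val_one]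
      have := Real.mul_self_sqrt hC0
      linear_combination (-(V i a * V j a) - V i b * V j b) * this
    · intro k hk
      rw [Finset.mem_erase, Finset.mem_erase] at hk
      rw [h0 k hk.2.1 hk.1, zero_mul]
  have hgram : ∀ i j, Z i j = X 0 i * X 0 j + X 1 i * X 1 j := by
    intro i j
    rw [hXZ, Matrix.mul_apply, Fin.sum_univ_two]; rfl
  have hR : R = polygonRadius K ^ 2 := by
    have h1 : ∑ i, Z i i = 2 * C := by
      have : ∀ i, Z i i = C * V i a ^ 2 + C * V i b ^ 2 := by
        intro i
        rw [hgram]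
        simp only [hX, Matrix.of_apply, Matrix.cons_val_zero, Matrix.cons_val_one]
        have := Real.mul_self_sqrt hC0
        linear_combination (V i a ^ 2 + V i b ^ 2) * this
      simp only [this, Finset.sum_add_distrib, ← Finset.mul_sum, hcol]; ring
    simp only [hdiag, Finset.sum_const, Finset.card_univ, Fintype.card_fin, nsmul_eq_mul] at h1
    have h2 : (K : ℝ) * R = K * polygonRadius K ^ 2 := by rw [h1, hC]; ring
    exact mul_left_cancel₀ hKpos.ne' h2
  obtain ⟨α, hα⟩ := exists_isRegularPolygon_of_separated hK (X := X) (polygonRadius_pos hK)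
    (polygonRadius_sq_mul hK)
    (fun i => by rw [← hR, ← hdiag i, hgram]; ring)
    (fun i j hij => by
      have h1 := hmargin i j hij
      have h2 := hgram i i
      have h3 := hgram j j
      rw [hgram] at h1
      rw [hdiag] at h2 h3
      nlinarith)
  exact ⟨X, α, hα, hXZ⟩

end Spectral

/-- The Schatten quasi-norm of an admissible matrix is minimised by regular polygons. -/
theorem eventually_le_sum_eigenvalues_rpow {K : ℕ} (hK : 2 < K) :
    ∀ᶠ p in nhdsWithin (0 : ℝ) (Set.Ioi 0), ∀ (Z V : Matrix (Fin K) (Fin K) ℝ)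
      (lam : Fin K → ℝ) (R : ℝ), Vᵀ * V = 1 → V * Vᵀ = 1 → Z = V * Matrix.diagonal lam * Vᵀ →
      (∀ k, 0 ≤ lam k) → (∀ i, Z i i = R) → (∀ i j, i ≠ j → 1 ≤ R - Z i j) →
      2 * (K * polygonRadius K ^ 2 / 2) ^ p ≤ ∑ k, lam k ^ p ∧
      (2 * (K * polygonRadius K ^ 2 / 2) ^ p = ∑ k, lam k ^ p →
        ∃ (X : Matrix (Fin 2) (Fin K) ℝ) (α : ℝ),
          IsRegularPolygon (polygonRadius K) α X ∧ Z = Xᵀ * X) := by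
  have hKpos : (0 : ℝ) < K := by exact_mod_cast (by omega : 0 < K)
  have hμ := polygonRadius_pos hK
  have hC : 0 < K * polygonRadius K ^ 2 / 2 := by positivity
  filter_upwards [eventually_le_rpow_sum hC, self_mem_nhdsWithin] with p hp hp0
  intro Z V lam R hV hV' hZ hlam hdiag hmargin
  have hp0 : 0 < p := hp0
  obtain ⟨a, -, ha⟩ := Finset.exists_max_image Finset.univ lam
    (Finset.card_pos.1 (by simp; omega))
  obtain ⟨b, hb1, hb⟩ := Finset.exists_max_image (Finset.univ.erase a) lam
    (Finset.card_pos.1 (by rw [Finset.card_erase_of_mem (by simp)]; simp; omega))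
  obtain ⟨c, hc1, hc⟩ := Finset.exists_max_image ((Finset.univ.erase a).erase b) lam
    (Finset.card_pos.1 (by
      rw [Finset.card_erase_of_mem hb1, Finset.card_erase_of_mem (by simp)]; simp; omega))
  have hab : a ≠ b := (Finset.ne_of_mem_erase hb1).symm
  have hle : ∀ k, k ≠ a → k ≠ b → lam k ≤ lam c := fun k hka hkb => hc k (by simp [hka, hkb])
  have hcb : lam c ≤ lam b := hb c (Finset.mem_of_mem_erase hc1)
  obtain ⟨h1, h2⟩ := hp (lam a) (lam b) (lam c) (hlam c) (ha c (by simp)) hcb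
    (fun h => top_eigenvalues_mul_ge hK hV hV' hZ hlam hdiag hmargin hab (hlam c) h hle)
  have hsum : lam a ^ p + lam b ^ p + lam c ^ p ≤ ∑ k, lam k ^ p := by
    rw [Finset.sum_eq_add_add_sum_erase hab]
    have := Finset.single_le_sum (f := fun k => lam k ^ p)
      (fun k _ => Real.rpow_nonneg (hlam k) p) hc1
    linarith
  refine ⟨h1.trans hsum, fun heq => ?_⟩
  obtain ⟨e1, e2, e3⟩ := h2 (by linarith)
  exact exists_isRegularPolygon_of_eigenvalues hK hV hZ hdiag hmargin hab e1 e2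
    (fun k hka hkb => le_antisymm (e3 ▸ hle k hka hkb) (hlam k))

/-! ### Minimal factorisations are balanced -/

theorem frobSq_eq_trace {m n : Type*} [Fintype m] [Fintype n] (A : Matrix m n ℝ) :
    frobSq A = (Aᵀ * A).trace := by
  rw [frobSq, Finset.sum_comm]
  simp only [Matrix.trace, Matrix.diag, Matrix.mul_apply, Matrix.transpose_apply, sq]

theorem frobSq_eq_trace' {m n : Type*} [Fintype m] [Fintype n] (A : Matrix m n ℝ) :
    frobSq A = (A * Aᵀ).trace := by
  rw [frobSq_eq_trace, Matrix.trace_mul_comm]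

theorem frobSq_nonneg {m n : Type*} [Fintype m] [Fintype n] (A : Matrix m n ℝ) :
    0 ≤ frobSq A :=
  Finset.sum_nonneg fun _ _ => Finset.sum_nonneg fun _ _ => sq_nonneg _

theorem sq_apply_le_frobSq {m n : Type*} [Fintype m] [Fintype n] (A : Matrix m n ℝ) (i : m)
    (j : n) : A i j ^ 2 ≤ frobSq A :=
  (Finset.single_le_sum (f := fun j => A i j ^ 2) (fun _ _ => sq_nonneg _)
    (Finset.mem_univ j)).trans
  (Finset.single_le_sum (f := fun i => ∑ j, A i j ^ 2)
    (fun _ _ => Finset.sum_nonneg fun _ _ => sq_nonneg _) (Finset.mem_univ i))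

theorem frobSq_add_smul {m n : Type*} [Fintype m] [Fintype n] (A B : Matrix m n ℝ) (t : ℝ) :
    frobSq (A + t • B) = frobSq A + 2 * t * (Aᵀ * B).trace + t ^ 2 * frobSq B := by
  have h : (Bᵀ * A).trace = (Aᵀ * B).trace := by
    rw [← Matrix.trace_transpose, Matrix.transpose_mul, Matrix.transpose_transpose]
  simp only [frobSq_eq_trace, Matrix.transpose_add, Matrix.transpose_smul, Matrix.add_mul,
    Matrix.mul_add, Matrix.smul_mul, Matrix.mul_smul, Matrix.trace_add, Matrix.trace_smul,
    smul_eq_mul, h]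
  ring

theorem eq_zero_of_forall_nonneg_add_sq {x M : ℝ} (hM : 0 ≤ M)
    (h : ∀ t : ℝ, |t| ≤ 1 / 2 → 0 ≤ 2 * t * x + t ^ 2 * M) : x = 0 := by
  by_contra hx
  set k := 2 * (|x| + M + 1) with hk
  have hx0 := abs_nonneg x
  have hk0 : 0 < k := by positivity
  have h1 := h (-x / k) (by
    rw [abs_div, abs_neg, abs_of_pos hk0, div_le_iff₀ hk0]; linarith)
  have h2 : 2 * (-x / k) * x + (-x / k) ^ 2 * M = x ^ 2 / k ^ 2 * (M - 2 * k) := by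
    field_simp; ring
  rw [h2] at h1
  have h3 : 0 < x ^ 2 / k ^ 2 := by positivity
  nlinarith

section Balanced

variable {σ : Type*} [Fintype σ] [DecidableEq σ]

/-- Two consecutive factors of minimal total Frobenius norm are balanced. -/
theorem balanced_of_forall_le {A B : Matrix σ σ ℝ}
    (h : ∀ G H : Matrix σ σ ℝ, G * H = 1 →
      frobSq A + frobSq B ≤ frobSq (A * G) + frobSq (H * B)) :
    Aᵀ * A = B * Bᵀ := by
  ext j i
  -- A matrix unit tests one entry of the balance equation. Since `S * S = c • S`, the inverse of `1
  -- + t • S` is explicit.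
  set S : Matrix σ σ ℝ := Matrix.single i j 1 with hS
  obtain ⟨c, hc0, hc1, hSS⟩ : ∃ c : ℝ, 0 ≤ c ∧ c ≤ 1 ∧ S * S = c • S := by
    rcases eq_or_ne i j with rfl | hij
    · exact ⟨1, by norm_num, le_rfl, by rw [hS, Matrix.single_mul_single_same]; simp⟩
    · exact ⟨0, le_rfl, by norm_num, by
        rw [hS, Matrix.single_mul_single_of_ne _ _ _ _ hij.symm]; simp⟩
  set p := (Aᵀ * (A * S)).trace with hp
  set q := (Bᵀ * (S * B)).trace with hq
  have hp' : p = (Aᵀ * A) j i := by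
    rw [hp, ← Matrix.mul_assoc, hS, Matrix.trace_mul_single]; simp
  have hq' : q = (B * Bᵀ) j i := by
    rw [hq, Matrix.trace_mul_comm, Matrix.mul_assoc, hS, Matrix.trace_single_mul]; simp
  rw [← hp', ← hq', ← sub_eq_zero]
  have ha := frobSq_nonneg (A * S)
  have hb := frobSq_nonneg (S * B)
  apply eq_zero_of_forall_nonneg_add_sq
    -- The second-order terms: `|t - u| ≤ 2t²` contributes `4|q|`, and `u² ≤ 4t²` contributes the
    -- last one.
    (M := frobSq (A * S) + 4 * |q| + 4 * frobSq (S * B)) (by positivity)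
  intro t ht
  rw [abs_le] at ht
  have hct : 1 / 2 ≤ 1 + c * t := by nlinarith
  set u := t / (1 + c * t) with hu
  have hut : u * (1 + c * t) = t := div_mul_cancel₀ t (by linarith)
  have hGH : (1 + t • S) * (1 + (-u) • S) = 1 := by
    simp only [Matrix.add_mul, Matrix.mul_add, Matrix.mul_one, Matrix.one_mul, Matrix.smul_mul,
      Matrix.mul_smul, hSS]
    have : -u + (t + t * (-u * c)) = 0 := by linarith
    calc _ = (1 : Matrix σ σ ℝ) + (-u + (t + t * (-u * c))) • S := by module
      _ = 1 := by rw [this, zero_smul, add_zero]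
  have h1 := h _ _ hGH
  rw [Matrix.mul_add, Matrix.add_mul, Matrix.mul_one, Matrix.one_mul, Matrix.mul_smul,
    Matrix.smul_mul, frobSq_add_smul, frobSq_add_smul, ← hp, ← hq] at h1
  have hu2 : u ^ 2 ≤ 4 * t ^ 2 := by
    have : t ^ 2 = u ^ 2 * (1 + c * t) ^ 2 := by rw [← mul_pow, hut]
    nlinarith [mul_nonneg (sq_nonneg u) (show 0 ≤ (1 + c * t) ^ 2 - 1 / 4 by nlinarith)]
  have hdiff : |t - u| ≤ 2 * t ^ 2 := by
    have h2 : t - u = c * (t * u) := by linarith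
    have h3 : |u| ≤ 2 * |t| := by
      apply abs_le_of_sq_le_sq' _ (by positivity) |> abs_le.2
      rw [mul_pow, sq_abs]; linarith
    rw [h2, abs_mul, abs_mul, abs_of_nonneg hc0]
    calc c * (|t| * |u|) ≤ 1 * (|t| * (2 * |t|)) := by gcongr
      _ = 2 * t ^ 2 := by rw [← sq_abs t]; ring
  have hq4 : (t - u) * q ≤ 2 * t ^ 2 * |q| := by
    calc (t - u) * q ≤ |(t - u) * q| := le_abs_self _
      _ = |t - u| * |q| := abs_mul _ _
      _ ≤ _ := by gcongr
  nlinarith [mul_le_mul_of_nonneg_right hu2 hb]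

theorem prod_update_gauge (A : ℕ → Matrix σ σ ℝ) {G H : Matrix σ σ ℝ} (hGH : G * H = 1) (l : ℕ)
    {N : ℕ} (hN : l + 1 < N) :
    ((List.range N).map
      (Function.update (Function.update A l (A l * G)) (l + 1) (H * A (l + 1)))).prod =
      ((List.range N).map A).prod := by
  set B := Function.update (Function.update A l (A l * G)) (l + 1) (H * A (l + 1)) with hB
  have hBl : B l = A l * G := by
    rw [hB, Function.update_of_ne (by omega), Function.update_self]
  have hBl1 : B (l + 1) = H * A (l + 1) := by rw [hB, Function.update_self]
  have hBne : ∀ k, k ≠ l → k ≠ l + 1 → B k = A k := fun k h1 h2 => by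
    rw [hB, Function.update_of_ne h2, Function.update_of_ne h1]
  have hlow : ((List.range l).map B).prod = ((List.range l).map A).prod := by
    congr 1
    apply List.map_congr_left
    intro k hk
    have := List.mem_range.1 hk
    exact hBne k (by omega) (by omega)
  induction N, hN using Nat.le_induction with
  | base =>
    rw [List.prod_range_succ, List.prod_range_succ, List.prod_range_succ, List.prod_range_succ,
      hlow, hBl, hBl1]
    simp only [Matrix.mul_assoc]
    rw [← Matrix.mul_assoc G, hGH, Matrix.one_mul]
  | succ m hm ih =>
    rw [List.prod_range_succ, List.prod_range_succ, ih, hBne m (by omega) (by omega)]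

/-- Induction from the left: balance replaces the inner `A 1 * (A 1)ᵀ` by `(A 0)ᵀ * A 0`, and `A 0`
then commutes past the power. -/
theorem prod_mul_transpose_of_balanced (N : ℕ) (A : ℕ → Matrix σ σ ℝ)
    (h : ∀ l, l + 1 < N → (A l)ᵀ * A l = A (l + 1) * (A (l + 1))ᵀ) :
    ((List.range N).map A).prod * ((List.range N).map A).prodᵀ = (A 0 * (A 0)ᵀ) ^ N := by
  induction N generalizing A with
  | zero => simp
  | succ N ih =>
    have h1 := ih (fun k => A (k + 1)) (fun l hl => h (l + 1) (by omega))
    rw [List.prod_range_succ', Matrix.transpose_mul, Matrix.mul_assoc,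
      ← Matrix.mul_assoc _ _ (A 0)ᵀ, h1]
    rcases N with _ | N
    · simp
    · rw [zero_add, ← h 0 (by omega)]
      have : ∀ k : ℕ, A 0 * ((A 0)ᵀ * A 0) ^ k = (A 0 * (A 0)ᵀ) ^ k * A 0 := by
        intro k
        induction k with
        | zero => simp
        | succ k ihk =>
          rw [pow_succ, ← Matrix.mul_assoc, ihk, pow_succ]; simp only [Matrix.mul_assoc]
      rw [← Matrix.mul_assoc, this, Matrix.mul_assoc, ← pow_succ]

theorem exists_minimal_factorization (A : ℕ → Matrix σ σ ℝ) (N : ℕ) :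
    ∃ B : ℕ → Matrix σ σ ℝ, ((List.range N).map B).prod = ((List.range N).map A).prod ∧
      (∑ i ∈ Finset.range N, frobSq (B i) ≤ ∑ i ∈ Finset.range N, frobSq (A i)) ∧
      ∀ C : ℕ → Matrix σ σ ℝ, ((List.range N).map C).prod = ((List.range N).map A).prod →
        ∑ i ∈ Finset.range N, frobSq (B i) ≤ ∑ i ∈ Finset.range N, frobSq (C i) := by
  set r := ∑ i ∈ Finset.range N, frobSq (A i) with hr
  set obj : (ℕ → Matrix σ σ ℝ) → ℝ := fun B => ∑ i ∈ Finset.range N, frobSq (B i) with hobj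
  -- Vanishing beyond `N` keeps the irrelevant tail bounded, so `S` sits in a product of compact
  -- boxes.
  set S : Set (ℕ → Matrix σ σ ℝ) := {B | ((List.range N).map B).prod = ((List.range N).map A).prod ∧
    obj B ≤ r ∧ ∀ i, N ≤ i → B i = 0} with hS
  have htrunc : ∀ C : ℕ → Matrix σ σ ℝ,
      ((List.range N).map (fun i => if i < N then C i else 0)).prod =
        ((List.range N).map C).prod ∧ obj (fun i => if i < N then C i else 0) = obj C := by
    intro C
    constructor
    · congr 1
      apply List.map_congr_left
      intro k hk
      rw [if_pos (List.mem_range.1 hk)]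
    · apply Finset.sum_congr rfl
      intro k hk
      simp only [if_pos (Finset.mem_range.1 hk)]
  have hcobj : Continuous obj := by
    apply continuous_finsetSum
    intro i _
    unfold frobSq
    apply continuous_finsetSum
    intro j _
    apply continuous_finsetSum
    intro k _
    exact ((continuous_apply i).matrix_elem j k).pow 2
  have hcprod : Continuous fun B : ℕ → Matrix σ σ ℝ => ((List.range N).map B).prod :=
    continuous_list_prod (f := fun i (B : ℕ → Matrix σ σ ℝ) => B i) _
      fun i _ => continuous_apply i
  have hclosed : IsClosed S := by
    rw [hS]
    apply IsClosed.and
    · exact isClosed_eq hcprod continuous_const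
    · apply IsClosed.and
      · exact isClosed_le hcobj continuous_const
      · simp only [Set.ofPred_forall]
        exact isClosed_iInter fun i => isClosed_iInter fun _ =>
          isClosed_eq (continuous_apply i) continuous_const
  have hbox : IsCompact (Set.univ.pi fun _ : ℕ => (Set.univ.pi fun _ : σ => Set.univ.pi fun _ : σ =>
      Set.Icc (-Real.sqrt r) (Real.sqrt r) : Set (Matrix σ σ ℝ))) :=
    isCompact_univ_pi fun _ => isCompact_univ_pi fun _ => isCompact_univ_pi fun _ => isCompact_Icc
  have hsub : S ⊆ Set.univ.pi fun _ : ℕ => (Set.univ.pi fun _ : σ => Set.univ.pi fun _ : σ =>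
      Set.Icc (-Real.sqrt r) (Real.sqrt r) : Set (Matrix σ σ ℝ)) := by
    rintro B ⟨-, hB, hB0⟩ i - j - k -
    refine abs_le.1 (?_ : |B i j k| ≤ Real.sqrt r)
    rcases lt_or_ge i N with hi | hi
    · apply Real.abs_le_sqrt
      exact (sq_apply_le_frobSq (B i) j k).trans
        ((Finset.single_le_sum (f := fun i => frobSq (B i)) (fun i _ => frobSq_nonneg _)
          (Finset.mem_range.2 hi)).trans hB)
    · rw [hB0 i hi]; simp
  obtain ⟨B, hBS, hBmin⟩ := (hbox.of_isClosed_subset hclosed hsub).exists_isMinOn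
    ⟨fun i => if i < N then A i else 0, (htrunc A).1, (htrunc A).2.le,
      fun i hi => if_neg (by omega)⟩ hcobj.continuousOn
  refine ⟨B, hBS.1, hBS.2.1, fun C hC => ?_⟩
  rcases le_or_gt (obj C) r with h | h
  · have := hBmin (show (fun i => if i < N then C i else 0) ∈ S from
      ⟨(htrunc C).1.trans hC, (htrunc C).2.le.trans h, fun i hi => if_neg (by omega)⟩)
    exact le_trans this (htrunc C).2.le
  · exact hBS.2.1.trans h.le

/-- The product `P` of `N` square matrices satisfies `P Pᵀ = M ^ N` for a positive semi-definite `M`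
whose trace bounds the mean squared Frobenius norm of the factors from below. -/
theorem exists_posSemidef_pow_eq (A : ℕ → Matrix σ σ ℝ) (N : ℕ) :
    ∃ M : Matrix σ σ ℝ, M.PosSemidef ∧
      M ^ N = ((List.range N).map A).prod * ((List.range N).map A).prodᵀ ∧
      N * M.trace ≤ ∑ i ∈ Finset.range N, frobSq (A i) := by
  obtain ⟨B, hBA, hle, hmin⟩ := exists_minimal_factorization A N
  have hbal : ∀ l, l + 1 < N → (B l)ᵀ * B l = B (l + 1) * (B (l + 1))ᵀ := by
    intro l hl
    apply balanced_of_forall_le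
    intro G H hGH
    have h1 := hmin _ ((prod_update_gauge B hGH l hl).trans hBA)
    have hm1 : l ∈ Finset.range N := Finset.mem_range.2 (by omega)
    have hm2 : l + 1 ∈ (Finset.range N).erase l := by simp [hl]
    rw [← Finset.add_sum_erase _ _ hm1, ← Finset.add_sum_erase _ _ hm2,
      ← Finset.add_sum_erase _ _ hm1, ← Finset.add_sum_erase _ _ hm2] at h1
    rw [Function.update_self, Function.update_of_ne (by omega), Function.update_self] at h1
    have h2 : ∑ x ∈ ((Finset.range N).erase l).erase (l + 1), frobSq
        (Function.update (Function.update B l (B l * G)) (l + 1) (H * B (l + 1)) x) =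
        ∑ x ∈ ((Finset.range N).erase l).erase (l + 1), frobSq (B x) := by
      apply Finset.sum_congr rfl
      intro k hk
      rw [Finset.mem_erase, Finset.mem_erase] at hk
      rw [Function.update_of_ne hk.1, Function.update_of_ne hk.2.1]
    rw [h2] at h1
    linarith
  refine ⟨B 0 * (B 0)ᵀ, ?_, ?_, ?_⟩
  · simpa using Matrix.posSemidef_self_mul_conjTranspose (B 0)
  · rw [← hBA, prod_mul_transpose_of_balanced N B hbal]
  · refine le_trans (le_of_eq ?_) hle
    have hconst : ∀ i, i < N → frobSq (B i) = frobSq (B 0) := by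
      intro i
      induction i with
      | zero => intro _; rfl
      | succ i ih =>
        intro hi
        rw [frobSq_eq_trace', ← hbal i hi, ← frobSq_eq_trace, ih (by omega)]
    rw [Finset.sum_congr rfl fun i hi => hconst i (Finset.mem_range.1 hi), Finset.sum_const,
      Finset.card_range, nsmul_eq_mul, ← frobSq_eq_trace']

end Balanced

/-! ### Schatten lower bound on the objective -/

/-- In an eigenbasis of `M` the equation holds entrywise, and nonnegative `N`-th roots are unique.
-/
theorem Matrix.PosSemidef.mul_eq_mul_diagonal_of_pow {σ κ : Type*} [Fintype σ] [DecidableEq σ]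
    [Fintype κ] [DecidableEq κ] {M : Matrix σ σ ℝ} (hM : M.PosSemidef) {N : ℕ} (hN : N ≠ 0)
    {U : Matrix σ κ ℝ} {s : κ → ℝ} (hs : ∀ k, 0 ≤ s k)
    (h : M ^ N * U = U * Matrix.diagonal fun k => s k ^ N) :
    M * U = U * Matrix.diagonal s := by
  obtain ⟨Q, m, hm, hQ, hQ', hMQ⟩ := hM.exists_orthogonal_diagonal
  have hpow : ∀ k : ℕ, Qᵀ * M ^ k = Matrix.diagonal (fun i => m i ^ k) * Qᵀ := by
    intro k
    induction k with
    | zero => simp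
    | succ k ih =>
      have : Qᵀ * M = Matrix.diagonal m * Qᵀ := by
        rw [hMQ, ← Matrix.mul_assoc, ← Matrix.mul_assoc, hQ, Matrix.one_mul]
      rw [pow_succ, ← Matrix.mul_assoc, ih, Matrix.mul_assoc, this, ← Matrix.mul_assoc,
        Matrix.diagonal_mul_diagonal]
      simp only [pow_succ]
  have h1 : Matrix.diagonal (fun i => m i ^ N) * (Qᵀ * U) =
      (Qᵀ * U) * Matrix.diagonal fun k => s k ^ N := by
    rw [← Matrix.mul_assoc, ← hpow, Matrix.mul_assoc, h, Matrix.mul_assoc]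
  have h2 : Matrix.diagonal m * (Qᵀ * U) = (Qᵀ * U) * Matrix.diagonal s := by
    ext i k
    have h3 := congrFun (congrFun h1 i) k
    rw [Matrix.diagonal_mul, Matrix.mul_diagonal] at h3
    rw [Matrix.diagonal_mul, Matrix.mul_diagonal]
    by_cases hW : (Qᵀ * U) i k = 0
    · rw [hW]; ring
    · rw [mul_comm] at h3
      rw [(pow_left_inj₀ (hm i) (hs k) hN).1 (mul_left_cancel₀ hW h3), mul_comm]
  calc M * U = Q * (Matrix.diagonal m * (Qᵀ * U)) := by rw [hMQ]; simp only [Matrix.mul_assoc]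
    _ = U * Matrix.diagonal s := by
      rw [h2, Matrix.mul_assoc, ← Matrix.mul_assoc, hQ', Matrix.one_mul]

theorem Matrix.PosSemidef.trace_compression_le {σ κ : Type*} [Fintype σ] [DecidableEq σ]
    [Fintype κ] [DecidableEq κ] {M : Matrix σ σ ℝ} (hM : M.PosSemidef)
    {U : Matrix σ κ ℝ} (hU : Uᵀ * U = 1) : (Uᵀ * (M * U)).trace ≤ M.trace := by
  set Q : Matrix σ σ ℝ := 1 - U * Uᵀ with hQ
  have hQT : Qᵀ = Q := by simp [hQ, Matrix.transpose_mul]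
  have hQQ : Q * Q = Q := by
    have : U * Uᵀ * (U * Uᵀ) = U * Uᵀ := by
      rw [Matrix.mul_assoc, ← Matrix.mul_assoc Uᵀ, hU, Matrix.one_mul]
    rw [hQ, Matrix.sub_mul, Matrix.mul_sub, Matrix.mul_sub, this]; simp
  have h1 : 0 ≤ (Q * M * Qᵀ).trace := by
    have := hM.mul_mul_conjTranspose_same Q
    rw [Matrix.conjTranspose_eq_transpose_of_trivial] at this
    exact this.trace_nonneg
  rw [hQT, Matrix.trace_mul_comm, ← Matrix.mul_assoc, hQQ, hQ, Matrix.sub_mul, Matrix.one_mul,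
    Matrix.trace_sub, Matrix.mul_assoc, Matrix.trace_mul_comm U, Matrix.mul_assoc] at h1
  linarith

theorem frobSq_mul_mul_transpose {m n σ τ : Type*} [Fintype m] [Fintype n] [Fintype σ] [Fintype τ]
    [DecidableEq m] [DecidableEq n] {E : Matrix σ m ℝ} {F : Matrix τ n ℝ} (hE : Eᵀ * E = 1)
    (hF : Fᵀ * F = 1) (A : Matrix m n ℝ) : frobSq (E * A * Fᵀ) = frobSq A := by
  have h : (E * A * Fᵀ)ᵀ * (E * A * Fᵀ) = F * ((Aᵀ * A) * Fᵀ) := by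
    simp only [Matrix.transpose_mul, Matrix.transpose_transpose, Matrix.mul_assoc]
    rw [← Matrix.mul_assoc Eᵀ E, hE, Matrix.one_mul]
  rw [frobSq_eq_trace, h, Matrix.trace_mul_comm, Matrix.mul_assoc, hF, Matrix.mul_one,
    frobSq_eq_trace]

theorem transpose_mul_prod_map {m σ : Type*} [Fintype m] [Fintype σ] [DecidableEq m]
    [DecidableEq σ] {E : Matrix σ m ℝ} (hE : Eᵀ * E = 1) (l : List (Matrix m m ℝ)) :
    Eᵀ * (l.map fun A => E * A * Eᵀ).prod = l.prod * Eᵀ := by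
  induction l with
  | nil => simp
  | cons A l ih =>
    rw [List.map_cons, List.prod_cons, List.prod_cons, ← Matrix.mul_assoc, ← Matrix.mul_assoc,
      ← Matrix.mul_assoc, hE, Matrix.one_mul, Matrix.mul_assoc, ih, Matrix.mul_assoc]

theorem transpose_mul_submatrix_one {α σ : Type*} [Fintype α] [Fintype σ] [DecidableEq α]
    [DecidableEq σ] {f : α → σ} (hf : Function.Injective f) :
    ((1 : Matrix σ σ ℝ).submatrix id f)ᵀ * (1 : Matrix σ σ ℝ).submatrix id f = 1 := by
  ext i j
  simp [Matrix.mul_apply, Matrix.one_apply, hf.eq_iff]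

theorem List.range_map_getD {α : Type*} (l : List α) (a : α) :
    (List.range l.length).map (fun i => l.getD i a) = l := by
  apply List.ext_getElem
  · simp
  · intro i h1 h2
    simp [List.getD_eq_getElem?_getD]
    simp at h1
    simp [h1]

/-- All layers become square blocks on the direct sum of output, hidden and sample spaces. The
coordinate inclusions are isometries, so neither products nor Frobenius norms are affected. -/
theorem UFMParams.exists_posSemidef {K n d L : ℕ} (hL : 1 ≤ L) (Θ : UFMParams K n d L) :
    ∃ (σ : Type) (_ : Fintype σ) (_ : DecidableEq σ) (M : Matrix σ σ ℝ) (E : Matrix σ (Fin K) ℝ),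
      M.PosSemidef ∧ Eᵀ * E = 1 ∧
      M ^ (L + 1) = E * (Θ.logits * Θ.logitsᵀ) * Eᵀ ∧ (L + 1 : ℕ) * M.trace ≤ Θ.objective := by
  refine ⟨Fin K ⊕ Fin d ⊕ (Fin K × Fin n), inferInstance, inferInstance, ?_⟩
  set σ := Fin K ⊕ Fin d ⊕ (Fin K × Fin n)
  set E : Matrix σ (Fin K) ℝ := (1 : Matrix σ σ ℝ).submatrix id Sum.inl with hEdef
  set D : Matrix σ (Fin d) ℝ := (1 : Matrix σ σ ℝ).submatrix id (Sum.inr ∘ Sum.inl) with hDdef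
  set F : Matrix σ (Fin K × Fin n) ℝ :=
    (1 : Matrix σ σ ℝ).submatrix id (Sum.inr ∘ Sum.inr) with hFdef
  have hE : Eᵀ * E = 1 := transpose_mul_submatrix_one Sum.inl_injective
  have hD : Dᵀ * D = 1 :=
    transpose_mul_submatrix_one (Sum.inr_injective.comp Sum.inl_injective)
  have hF : Fᵀ * F = 1 :=
    transpose_mul_submatrix_one (Sum.inr_injective.comp Sum.inr_injective)
  set l : List (Matrix σ σ ℝ) := E * Θ.last * Dᵀ ::
    (((List.ofFn Θ.hidden).reverse.map fun A => D * A * Dᵀ) ++ [D * Θ.feat * Fᵀ]) with hl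
  have hlen : l.length = L + 1 := by simp [hl]; omega
  have hprod : l.prod = E * Θ.logits * Fᵀ := by
    rw [hl, List.prod_cons, List.prod_append, List.prod_singleton, ← Matrix.mul_assoc,
      Matrix.mul_assoc (E * Θ.last), transpose_mul_prod_map hD, UFMParams.logits]
    simp only [Matrix.mul_assoc]
    rw [← Matrix.mul_assoc Dᵀ D, hD, Matrix.one_mul]
  have hsum : (l.map frobSq).sum = Θ.objective := by
    rw [hl, List.map_cons, List.sum_cons, List.map_append, List.sum_append, List.map_map,
      List.map_reverse, List.sum_reverse, List.map_ofFn, List.sum_ofFn, UFMParams.objective]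
    simp only [Function.comp_def, frobSq_mul_mul_transpose hE hD, frobSq_mul_mul_transpose hD hD,
      frobSq_mul_mul_transpose hD hF, List.map_cons, List.map_nil, List.sum_singleton]
    ring
  -- The default `1` is never read: `l` has length `L + 1`.
  obtain ⟨M, hM, hMpow, hMtr⟩ := exists_posSemidef_pow_eq (fun i => l.getD i 1) (L + 1)
  rw [← hlen, List.range_map_getD, hlen, hprod] at hMpow
  refine ⟨M, E, hM, hE, ?_, ?_⟩
  · rw [hMpow]
    simp only [Matrix.transpose_mul, Matrix.transpose_transpose, Matrix.mul_assoc]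
    rw [← Matrix.mul_assoc Fᵀ F, hF, Matrix.one_mul]
  · refine hMtr.trans_eq ?_
    rw [← hsum]
    conv_rhs => rw [← List.range_map_getD l 1, hlen, List.map_map]
    rw [Finset.sum_range, ← List.sum_ofFn, List.ofFn_eq_map, ← List.map_coe_finRange_eq_range,
      List.map_map]
    rfl

theorem repeatCols_mul_transpose {K : ℕ} (n : ℕ) (Z : Matrix (Fin K) (Fin K) ℝ) :
    repeatCols n Z * (repeatCols n Z)ᵀ = (n : ℝ) • (Z * Zᵀ) := by
  ext i j
  simp [Matrix.mul_apply, repeatCols, Fintype.sum_prod_type, Finset.mul_sum]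

/-- The Schatten lower bound on the objective. -/
theorem UFMParams.sum_eigenvalues_rpow_le_objective {K n d L : ℕ} (hL : 1 ≤ L)
    (Θ : UFMParams K n d L) {Z V : Matrix (Fin K) (Fin K) ℝ} {lam : Fin K → ℝ}
    (hV : Vᵀ * V = 1) (hZ : Z = V * Matrix.diagonal lam * Vᵀ)
    (hlam : ∀ k, 0 ≤ lam k) (hlog : Θ.logits = repeatCols n Z) :
    (L + 1) * (Real.sqrt n ^ (2 / (L + 1) : ℝ) * ∑ k, lam k ^ (2 / (L + 1) : ℝ)) ≤
      Θ.objective := by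
  obtain ⟨σ, _, _, M, E, hM, hE, hpow, htr⟩ := Θ.exists_posSemidef hL
  -- Repeating columns `n` times scales the singular values by `√n`; the `s k` are eigenvalues of
  -- `M`.
  set s : Fin K → ℝ := fun k => (Real.sqrt n * lam k) ^ (2 / (L + 1) : ℝ) with hs
  have hs0 : ∀ k, 0 ≤ s k := fun k =>
    Real.rpow_nonneg (mul_nonneg (Real.sqrt_nonneg _) (hlam k)) _
  have hspow : ∀ k, s k ^ (L + 1) = n * lam k ^ 2 := by
    intro k
    have h0 : 0 ≤ Real.sqrt n * lam k := mul_nonneg (Real.sqrt_nonneg _) (hlam k)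
    simp only [hs]
    rw [← Real.rpow_natCast, ← Real.rpow_mul h0]
    have : (2 / (L + 1) : ℝ) * ((L + 1 : ℕ) : ℝ) = ((2 : ℕ) : ℝ) := by
      push_cast; field_simp
    rw [this, Real.rpow_natCast, mul_pow, Real.sq_sqrt (Nat.cast_nonneg n)]
  set U := E * V with hUdef
  have hU : Uᵀ * U = 1 := by
    rw [hUdef, Matrix.transpose_mul, Matrix.mul_assoc, ← Matrix.mul_assoc Eᵀ, hE, Matrix.one_mul,
      hV]
  have hMU : M ^ (L + 1) * U = U * Matrix.diagonal fun k => s k ^ (L + 1) := by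
    have h1 : Z * (Zᵀ * V) = V * Matrix.diagonal fun k => lam k ^ 2 := by
      rw [hZ]
      simp only [Matrix.transpose_mul, Matrix.transpose_transpose, Matrix.diagonal_transpose,
        Matrix.mul_assoc, hV, Matrix.mul_one]
      rw [← Matrix.mul_assoc Vᵀ, hV, Matrix.one_mul, Matrix.diagonal_mul_diagonal]
      simp only [sq]
    have h2 : (Matrix.diagonal fun k => s k ^ (L + 1)) =
        (n : ℝ) • Matrix.diagonal fun k => lam k ^ 2 := by
      rw [← Matrix.diagonal_smul]
      congr 1
      ext k
      simp [hspow]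
    rw [hpow, hlog, repeatCols_mul_transpose, hUdef, h2]
    simp only [Matrix.mul_assoc, Matrix.smul_mul, Matrix.mul_smul]
    rw [← Matrix.mul_assoc Eᵀ E, hE, Matrix.one_mul, h1]
  have h3 := hM.mul_eq_mul_diagonal_of_pow (Nat.succ_ne_zero L) hs0 hMU
  have h4 := hM.trace_compression_le hU
  rw [h3, ← Matrix.mul_assoc, hU, Matrix.one_mul, Matrix.trace_diagonal] at h4
  have h5 : Real.sqrt n ^ (2 / (L + 1) : ℝ) * ∑ k, lam k ^ (2 / (L + 1) : ℝ) = ∑ k, s k := by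
    rw [Finset.mul_sum]
    exact Finset.sum_congr rfl fun k _ => (Real.mul_rpow (Real.sqrt_nonneg _) (hlam k)).symm
  rw [h5]
  refine le_trans ?_ htr
  push_cast
  gcongr

/-! ### Regular polygons are feasible and attain the bound -/

theorem exists_isRegularPolygon (K : ℕ) (μ : ℝ) :
    ∃ X : Matrix (Fin 2) (Fin K) ℝ, IsRegularPolygon μ 0 X :=
  ⟨(Matrix.of fun i : Fin K =>
      ![μ * Real.cos (2 * Real.pi * (i : ℝ) / K + 0),
        μ * Real.sin (2 * Real.pi * (i : ℝ) / K + 0)])ᵀ, rfl⟩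

theorem cos_two_pi_mul_div_le {K : ℕ} (hK : 2 < K) {i j : Fin K} (hij : i ≠ j) (α : ℝ) :
    Real.cos ((2 * Real.pi * (i : ℝ) / K + α) - (2 * Real.pi * (j : ℝ) / K + α)) ≤
      Real.cos (2 * Real.pi / K) := by
  have hpi := Real.pi_pos
  wlog h : j < i generalizing i j
  · rw [← Real.cos_neg, neg_sub]
    exact this hij.symm (lt_of_le_of_ne (not_lt.1 h) hij)
  have hK0 : (0 : ℝ) < K := by exact_mod_cast (by omega : 0 < K)
  have hK3 : (3 : ℝ) ≤ K := by exact_mod_cast hK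
  set δ := 2 * Real.pi / K with hδ
  have hδK : K * δ = 2 * Real.pi := by rw [hδ]; field_simp
  have hδ0 : 0 < δ := by positivity
  have hδpi : δ ≤ Real.pi := by nlinarith
  set m : ℝ := (i : ℝ) - (j : ℝ) with hm
  have hm1 : 1 ≤ m := by
    have : (j : ℝ) + 1 ≤ i := by exact_mod_cast h
    linarith
  have hm2 : m ≤ K - 1 := by
    have h1 : (i : ℝ) + 1 ≤ K := by exact_mod_cast i.2
    have h2 : (0 : ℝ) ≤ (j : ℕ) := Nat.cast_nonneg _
    linarith
  have harg : (2 * Real.pi * (i : ℝ) / K + α) - (2 * Real.pi * (j : ℝ) / K + α) = m * δ := by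
    rw [hδ, hm]; ring
  rw [harg]
  rcases le_total (m * δ) Real.pi with h1 | h1
  · exact Real.cos_le_cos_of_nonneg_of_le_pi hδ0.le h1 (by nlinarith)
  · rw [← Real.cos_two_pi_sub]
    exact Real.cos_le_cos_of_nonneg_of_le_pi hδ0.le (by linarith) (by nlinarith)

section Polygon

variable {K : ℕ} {μ α : ℝ} {X : Matrix (Fin 2) (Fin K) ℝ}

theorem IsRegularPolygon.exists_perm (hK : 2 < K) (hμ : 0 < μ) (hX : IsRegularPolygon μ α X) :
    ∃ τ : Equiv.Perm (Fin K), ∀ c,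
      X 0 c = μ * Real.cos (2 * Real.pi * (τ c : ℝ) / K + α) ∧
      X 1 c = μ * Real.sin (2 * Real.pi * (τ c : ℝ) / K + α) := by
  set P : Fin K → Fin 2 → ℝ := fun i =>
    ![μ * Real.cos (2 * Real.pi * (i : ℝ) / K + α),
      μ * Real.sin (2 * Real.pi * (i : ℝ) / K + α)] with hP
  have hinj : Function.Injective P := by
    intro i j hij
    by_contra hne
    have h0 := congrFun hij 0
    have h1 := congrFun hij 1
    simp only [hP, Matrix.cons_val_zero, Matrix.cons_val_one] at h0 h1
    have h2 := cos_two_pi_mul_div_le hK hne α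
    rw [Real.cos_sub, mul_left_cancel₀ hμ.ne' h0, mul_left_cancel₀ hμ.ne' h1, ← sq, ← sq,
      Real.cos_sq_add_sin_sq] at h2
    linarith [cos_two_pi_div_lt_one hK]
  have hmem : ∀ c, ∃ i, P i = Xᵀ c := fun c => by
    have : Xᵀ c ∈ Set.range fun c => Xᵀ c := ⟨c, rfl⟩
    rw [IsRegularPolygon] at hX
    rw [hX] at this
    exact this
  choose τ hτ using hmem
  have hsurj : Function.Surjective τ := by
    intro i
    have : P i ∈ Set.range P := ⟨i, rfl⟩
    rw [IsRegularPolygon] at hX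
    rw [← hX] at this
    obtain ⟨c, hc⟩ := this
    exact ⟨c, hinj ((hτ c).trans hc)⟩
  refine ⟨Equiv.ofBijective τ (Finite.injective_iff_bijective.1
    (Finite.injective_iff_surjective.2 hsurj)), fun c => ⟨?_, ?_⟩⟩
  · have := congrFun (hτ c) 0
    simpa [hP] using this.symm
  · have := congrFun (hτ c) 1
    simpa [hP] using this.symm

theorem IsRegularPolygon.gram_apply_self (hK : 2 < K) (hμ : 0 < μ) (hX : IsRegularPolygon μ α X)
    (c : Fin K) : ∑ k, X k c ^ 2 = μ ^ 2 := by
  obtain ⟨τ, hτ⟩ := hX.exists_perm hK hμ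
  rw [Fin.sum_univ_two, (hτ c).1, (hτ c).2, mul_pow, mul_pow, ← mul_add, Real.cos_sq_add_sin_sq,
    mul_one]

theorem IsRegularPolygon.gram_apply_le (hK : 2 < K) (hμ : 0 < μ) (hX : IsRegularPolygon μ α X)
    {c c' : Fin K} (h : c' ≠ c) :
    (Xᵀ * X) c' c ≤ μ ^ 2 * Real.cos (2 * Real.pi / K) := by
  obtain ⟨τ, hτ⟩ := hX.exists_perm hK hμ
  have h1 := cos_two_pi_mul_div_le hK (τ.injective.ne h) α
  rw [Real.cos_sub] at h1
  rw [Matrix.mul_apply, Fin.sum_univ_two, Matrix.transpose_apply, Matrix.transpose_apply,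
    (hτ c).1, (hτ c).2, (hτ c').1, (hτ c').2]
  nlinarith [mul_le_mul_of_nonneg_left h1 (sq_nonneg μ)]

theorem IsRegularPolygon.mul_transpose (hK : 2 < K) (hμ : 0 < μ) (hX : IsRegularPolygon μ α X) :
    X * Xᵀ = (K * μ ^ 2 / 2) • (1 : Matrix (Fin 2) (Fin 2) ℝ) := by
  obtain ⟨τ, hτ⟩ := hX.exists_perm hK hμ
  have hpi := Real.pi_pos
  have hK0 : (0 : ℝ) < K := by exact_mod_cast (by omega : 0 < K)
  set φ : Fin K → ℝ := fun i => 2 * Real.pi * (i : ℝ) / K + α with hφ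
  have hκ : 0 < 1 - Real.cos (2 * Real.pi / K) := sub_pos.2 (cos_two_pi_div_lt_one hK)
  have hrange : ∀ i j, |φ i - φ j| ≤ 2 * Real.pi := by
    intro i j
    have h1 : φ i - φ j = 2 * Real.pi / K * ((i : ℝ) - (j : ℝ)) := by simp only [hφ]; ring
    have h2 : |(i : ℝ) - (j : ℝ)| ≤ K := by
      have hi : (i : ℝ) ≤ K := by exact_mod_cast i.2.le
      have hj : (j : ℝ) ≤ K := by exact_mod_cast j.2.le
      have hi0 : (0 : ℝ) ≤ (i : ℕ) := Nat.cast_nonneg _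
      have hj0 : (0 : ℝ) ≤ (j : ℕ) := Nat.cast_nonneg _
      rw [abs_le]; constructor <;> linarith
    rw [h1, abs_mul, abs_of_nonneg (by positivity)]
    calc 2 * Real.pi / K * |(i : ℝ) - (j : ℝ)| ≤ 2 * Real.pi / K * K := by gcongr
      _ = 2 * Real.pi := by field_simp
  -- At the extremal separation the left side is already `K²`, so both second harmonic sums vanish;
  -- no geometric series is needed.
  have h := sq_le_sub_sq_sum_cos hK hκ hrange
    (fun i j hij => sub_le_sub_left (cos_two_pi_mul_div_le hK hij α) 1)
  rw [div_self hκ.ne'] at h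
  have hA : ∑ i, Real.cos (2 * φ i) = 0 := by
    nlinarith [sq_nonneg (∑ i, Real.cos (2 * φ i)), sq_nonneg (∑ i, Real.sin (2 * φ i))]
  have hB : ∑ i, Real.sin (2 * φ i) = 0 := by
    nlinarith [sq_nonneg (∑ i, Real.cos (2 * φ i)), sq_nonneg (∑ i, Real.sin (2 * φ i))]
  have h00 : ∑ c, X 0 c * X 0 c = K * μ ^ 2 / 2 := by
    have : ∀ c, X 0 c * X 0 c = μ ^ 2 / 2 + μ ^ 2 / 2 * Real.cos (2 * φ (τ c)) := by
      intro c
      rw [(hτ c).1, Real.cos_two_mul]; ring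
    rw [Finset.sum_congr rfl fun c _ => this c, Finset.sum_add_distrib, ← Finset.mul_sum,
      Equiv.sum_comp τ fun i => Real.cos (2 * φ i), hA]
    simp; ring
  have h11 : ∑ c, X 1 c * X 1 c = K * μ ^ 2 / 2 := by
    have : ∀ c, X 1 c * X 1 c = μ ^ 2 / 2 - μ ^ 2 / 2 * Real.cos (2 * φ (τ c)) := by
      intro c
      rw [(hτ c).2, Real.cos_two_mul, Real.cos_sq']; ring
    rw [Finset.sum_congr rfl fun c _ => this c, Finset.sum_sub_distrib, ← Finset.mul_sum,
      Equiv.sum_comp τ fun i => Real.cos (2 * φ i), hA]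
    simp; ring
  have h01 : ∑ c, X 0 c * X 1 c = 0 := by
    have : ∀ c, X 0 c * X 1 c = μ ^ 2 / 2 * Real.sin (2 * φ (τ c)) := by
      intro c
      rw [(hτ c).1, (hτ c).2, Real.sin_two_mul]; ring
    rw [Finset.sum_congr rfl fun c _ => this c, ← Finset.mul_sum,
      Equiv.sum_comp τ fun i => Real.sin (2 * φ i), hB, mul_zero]
  have h10 : ∑ c, X 1 c * X 0 c = 0 := by
    rw [← h01]; exact Finset.sum_congr rfl fun c _ => mul_comm _ _
  ext i j
  fin_cases i <;> fin_cases j <;>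
    simp [Matrix.mul_apply, h00, h11, h01, h10]

theorem IsRegularPolygon.marginFeasible (hK : 2 < K) (hμ : 0 < μ)
    (hμ2 : μ ^ 2 * (1 - Real.cos (2 * Real.pi / K)) = 1) (hX : IsRegularPolygon μ α X) (n : ℕ) :
    MarginFeasible (repeatCols n (Xᵀ * X)) := by
  intro c c' i hc
  have h1 := hX.gram_apply_le hK hμ hc
  have h2 : (Xᵀ * X) c c = μ ^ 2 := by
    rw [← hX.gram_apply_self hK hμ c, Matrix.mul_apply]
    exact Finset.sum_congr rfl fun k _ => (sq _).symm
  simp only [repeatCols, Matrix.of_apply, h2]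
  linarith

theorem IsRegularPolygon.admissibleLogits (hK : 2 < K) (hμ : 0 < μ)
    (hX : IsRegularPolygon μ α X) (n : ℕ) :
    AdmissibleLogits (repeatCols n (Xᵀ * X)) :=
  ⟨Xᵀ * X, rfl, by simpa using Matrix.posSemidef_conjTranspose_mul_self X,
    2, X, μ, rfl, hX.gram_apply_self hK hμ⟩

/-- The balanced factorisation of the logits given by a regular polygon. -/
theorem IsRegularPolygon.exists_params (hK : 2 < K) (hμ : 0 < μ)
    (hX : IsRegularPolygon μ α X) {n d L : ℕ} (hn : 1 ≤ n) (hd : K ≤ d) (hL : 1 ≤ L) :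
    ∃ Θ : UFMParams K n d L, Θ.logits = repeatCols n (Xᵀ * X) ∧
      Θ.objective = (L + 1) * (Real.sqrt n ^ (2 / (L + 1) : ℝ) *
        (2 * (K * μ ^ 2 / 2) ^ (2 / (L + 1) : ℝ))) := by
  have hK0 : (0 : ℝ) < K := by exact_mod_cast (by omega : 0 < K)
  have hn0 : (0 : ℝ) < n := by exact_mod_cast hn
  set C : ℝ := K * μ ^ 2 / 2 with hC
  have hC0 : 0 < C := by positivity
  have hXX : X * Xᵀ = C • (1 : Matrix (Fin 2) (Fin 2) ℝ) := hX.mul_transpose hK hμ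
  have hsn : 0 < Real.sqrt n := Real.sqrt_pos.2 hn0
  have hsC : 0 < Real.sqrt C := Real.sqrt_pos.2 hC0
  -- The logits have two equal nonzero singular values `√n * C`; every layer gets two singular
  -- values `t`, hence squared norm `2t²`.
  set t : ℝ := (Real.sqrt n * C) ^ (1 / (L + 1) : ℝ) with ht
  have ht1 : t ^ (L + 1) = Real.sqrt n * C := by
    rw [ht, ← Real.rpow_natCast, ← Real.rpow_mul (by positivity)]
    have : (1 / (L + 1) : ℝ) * ((L + 1 : ℕ) : ℝ) = 1 := by push_cast; field_simp
    rw [this, Real.rpow_one]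
  have ht2 : t ^ 2 = Real.sqrt n ^ (2 / (L + 1) : ℝ) * C ^ (2 / (L + 1) : ℝ) := by
    rw [ht, ← Real.rpow_natCast, ← Real.rpow_mul (by positivity),
      ← Real.mul_rpow hsn.le hC0.le]
    congr 1; push_cast; ring
  have h2d : 2 ≤ d := by omega
  set J : Matrix (Fin d) (Fin 2) ℝ := (1 : Matrix (Fin d) (Fin d) ℝ).submatrix id (Fin.castLE h2d)
  have hJ : Jᵀ * J = 1 := transpose_mul_submatrix_one (Fin.castLE_injective h2d)
  set Y : Matrix (Fin 2) (Fin K × Fin n) ℝ := Matrix.of fun k ci => X k ci.1 with hY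
  have hYY : Y * Yᵀ = (n : ℝ) • (X * Xᵀ) := by
    ext i j
    simp [Matrix.mul_apply, hY, Fintype.sum_prod_type, Finset.mul_sum]
  have hXY : Xᵀ * Y = repeatCols n (Xᵀ * X) := by
    ext i j
    simp [Matrix.mul_apply, hY, repeatCols]
  set W : Matrix (Fin K) (Fin d) ℝ := (t / Real.sqrt C) • (Xᵀ * Jᵀ) with hW
  set H : Matrix (Fin d) (Fin d) ℝ := t • (J * Jᵀ) with hH
  set G : Matrix (Fin d) (Fin K × Fin n) ℝ := (t / (Real.sqrt n * Real.sqrt C)) • (J * Y) with hG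
  have hWH : ∀ m : ℕ, W * H ^ m = t ^ m • W := by
    intro m
    induction m with
    | zero => simp
    | succ m ih =>
      have h1 : W * H = t • W := by
        rw [hW, hH, Matrix.smul_mul, Matrix.mul_smul, Matrix.mul_assoc, ← Matrix.mul_assoc Jᵀ, hJ,
          Matrix.one_mul, smul_comm]
      rw [pow_succ, ← Matrix.mul_assoc, ih, Matrix.smul_mul, h1, smul_smul, pow_succ]
  have hsC2 := Real.mul_self_sqrt hC0.le
  refine ⟨⟨W, fun _ => H, G⟩, ?_, ?_⟩
  · rw [UFMParams.logits]
    simp only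
    rw [List.ofFn_const, List.reverse_replicate, List.prod_replicate, hWH, hW, hG]
    simp only [Matrix.smul_mul, Matrix.mul_smul, smul_smul, Matrix.mul_assoc]
    rw [← Matrix.mul_assoc Jᵀ, hJ, Matrix.one_mul, hXY]
    have h1 : t ^ (L - 1) * (t / Real.sqrt C * (t / (Real.sqrt n * Real.sqrt C))) = 1 := by
      have h2 : t ^ (L + 1) = t ^ (L - 1) * t * t := by
        rw [← pow_succ, ← pow_succ]; congr 1; omega
      have h3 : t ^ (L - 1) * (t / Real.sqrt C * (t / (Real.sqrt n * Real.sqrt C))) =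
          t ^ (L - 1) * t * t / (Real.sqrt n * (Real.sqrt C * Real.sqrt C)) := by
        field_simp
      rw [h3, ← h2, ht1, hsC2, div_self (by positivity)]
    convert one_smul ℝ (repeatCols n (Xᵀ * X)) using 2
    rw [← h1]; ring
  · have hfW : frobSq W = 2 * t ^ 2 := by
      have : W * Wᵀ = (t / Real.sqrt C) ^ 2 • (Xᵀ * X) := by
        rw [hW, Matrix.transpose_smul, Matrix.smul_mul, Matrix.mul_smul, smul_smul,
          Matrix.transpose_mul, Matrix.transpose_transpose, Matrix.transpose_transpose,
          Matrix.mul_assoc, ← Matrix.mul_assoc Jᵀ, hJ, Matrix.one_mul, sq]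
      rw [frobSq_eq_trace', this, Matrix.trace_smul, Matrix.trace_mul_comm, hXX, Matrix.trace_smul,
        Matrix.trace_one, div_pow, Real.sq_sqrt hC0.le]
      simp; field_simp
    have hfH : frobSq H = 2 * t ^ 2 := by
      have : H * Hᵀ = t ^ 2 • (J * Jᵀ) := by
        rw [hH, Matrix.transpose_smul, Matrix.smul_mul, Matrix.mul_smul, smul_smul,
          Matrix.transpose_mul, Matrix.transpose_transpose,
          Matrix.mul_assoc, ← Matrix.mul_assoc Jᵀ, hJ, Matrix.one_mul, sq]
      rw [frobSq_eq_trace', this, Matrix.trace_smul, Matrix.trace_mul_comm, hJ,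
        Matrix.trace_one]
      simp; ring
    have hfG : frobSq G = 2 * t ^ 2 := by
      have : Gᵀ * G = (t / (Real.sqrt n * Real.sqrt C)) ^ 2 • (Yᵀ * Y) := by
        rw [hG, Matrix.transpose_smul, Matrix.smul_mul, Matrix.mul_smul, smul_smul,
          Matrix.transpose_mul, Matrix.mul_assoc, ← Matrix.mul_assoc Jᵀ, hJ, Matrix.one_mul, sq]
      rw [frobSq_eq_trace, this, Matrix.trace_smul, Matrix.trace_mul_comm, hYY, hXX,
        Matrix.trace_smul, Matrix.trace_smul, Matrix.trace_one, div_pow, mul_pow,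
        Real.sq_sqrt hC0.le, Real.sq_sqrt hn0.le]
      simp; field_simp
    rw [UFMParams.objective]
    simp only [hfW, hfH, hfG, Finset.sum_const, Finset.card_univ, Fintype.card_fin, nsmul_eq_mul]
    rw [Nat.cast_sub hL, ht2]
    push_cast
    ring

end Polygon

/-! ### Comparison and conclusion -/

/-- The exponent `2 / (L + 1)` tends to `0` from above, so the small-exponent estimate applies for
large `L`. That estimate involves only `K`, so the threshold is uniform in `n` and `d`. -/
theorem UFMParams.le_objective_of_admissible {K : ℕ} (hK : 2 < K) :
    ∀ᶠ L : ℕ in Filter.atTop, ∀ n d : ℕ, 1 ≤ n → ∀ Θ : UFMParams K n d L,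
      MarginFeasible Θ.logits → AdmissibleLogits Θ.logits →
      (L + 1) * (Real.sqrt n ^ (2 / (L + 1) : ℝ) *
        (2 * (K * polygonRadius K ^ 2 / 2) ^ (2 / (L + 1) : ℝ))) ≤ Θ.objective ∧
      (Θ.objective ≤ (L + 1) * (Real.sqrt n ^ (2 / (L + 1) : ℝ) *
          (2 * (K * polygonRadius K ^ 2 / 2) ^ (2 / (L + 1) : ℝ))) →
        ∃ (X : Matrix (Fin 2) (Fin K) ℝ) (α : ℝ),
          IsRegularPolygon (polygonRadius K) α X ∧ Θ.logits = repeatCols n (Xᵀ * X)) := by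
  have hlim : Filter.Tendsto (fun L : ℕ => (2 / (L + 1) : ℝ)) Filter.atTop
      (nhdsWithin 0 (Set.Ioi 0)) := by
    refine tendsto_nhdsWithin_iff.2 ⟨?_, Filter.Eventually.of_forall fun L =>
      Set.mem_Ioi.2 (by positivity)⟩
    have := (tendsto_one_div_add_atTop_nhds_zero_nat (𝕜 := ℝ)).const_mul 2
    simpa [div_eq_mul_inv] using this
  filter_upwards [hlim.eventually (eventually_le_sum_eigenvalues_rpow hK),
    Filter.eventually_ge_atTop 1] with L hp hL
  rintro n d hn Θ hmar ⟨Z, hlog, hpsd, m, Y, r, hZY, hr⟩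
  obtain ⟨V, lam, hlam, hV, hV', hZ⟩ := hpsd.exists_orthogonal_diagonal
  have hdiag : ∀ i, Z i i = r ^ 2 := by
    intro i
    rw [hZY, ← hr i, Matrix.mul_apply]
    exact Finset.sum_congr rfl fun k _ => (sq _).symm
  have hmargin : ∀ i j, i ≠ j → 1 ≤ r ^ 2 - Z i j := by
    intro i j hij
    have := hmar j i ⟨0, hn⟩ hij
    rw [hlog] at this
    simp only [repeatCols, Matrix.of_apply, hdiag] at this
    exact this
  obtain ⟨h1, h2⟩ := hp Z V lam (r ^ 2) hV hV' hZ hlam hdiag hmargin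
  have h3 := Θ.sum_eigenvalues_rpow_le_objective hL hV hZ hlam hlog
  have hn0 : 0 < Real.sqrt n ^ (2 / (L + 1) : ℝ) :=
    Real.rpow_pos_of_pos (Real.sqrt_pos.2 (by exact_mod_cast hn)) _
  have hL0 : (0 : ℝ) < L + 1 := by positivity
  refine ⟨le_trans (by gcongr) h3, fun hle => ?_⟩
  have h4 := h3.trans hle
  have h5 := le_of_mul_le_mul_left (le_of_mul_le_mul_left h4 hL0) hn0
  obtain ⟨X, α, hX, hZX⟩ := h2 (le_antisymm h1 h5)
  exact ⟨X, α, hX, by rw [hlog, hZX]⟩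

theorem mainTheorem2 (K : ℕ) (hK : 2 < K) :
    ∃ μ : ℝ, 0 < μ ∧
      ∀ᶠ L : ℕ in Filter.atTop, ∀ n d : ℕ, 1 ≤ n → K ≤ d →
        ∀ Z : Matrix (Fin K) (Fin K × Fin n) ℝ,
          (∃ Θ : UFMParams K n d L, Θ.IsGlobalOptimum ∧ Θ.logits = Z) ↔
            ∃ (X : Matrix (Fin 2) (Fin K) ℝ) (α : ℝ),
              IsRegularPolygon μ α X ∧ Z = repeatCols n (Xᵀ * X) := by
  have hμ := polygonRadius_pos hK
  have hμ2 := polygonRadius_sq_mul hK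
  refine ⟨polygonRadius K, hμ, ?_⟩
  filter_upwards [UFMParams.le_objective_of_admissible hK, Filter.eventually_ge_atTop 1]
    with L hbound hL
  intro n d hn hd Z
  constructor
  · rintro ⟨Θ, ⟨⟨hmar, hadm⟩, hopt⟩, rfl⟩
    obtain ⟨X, hX⟩ := exists_isRegularPolygon K (polygonRadius K)
    obtain ⟨Θ', hlog, hobj⟩ := hX.exists_params hK hμ hn hd hL
    refine (hbound n d hn Θ hmar hadm).2 (hobj ▸ hopt Θ' ?_ ?_)
    · rw [hlog]; exact hX.marginFeasible hK hμ hμ2 n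
    · rw [hlog]; exact hX.admissibleLogits hK hμ n
  · rintro ⟨X, α, hX, rfl⟩
    obtain ⟨Θ, hlog, hobj⟩ := hX.exists_params hK hμ hn hd hL
    refine ⟨Θ, ⟨⟨?_, ?_⟩, fun Θ' hmar hadm => ?_⟩, hlog⟩
    · rw [hlog]; exact hX.marginFeasible hK hμ hμ2 n
    · rw [hlog]; exact hX.admissibleLogits hK hμ n
    · rw [hobj]; exact (hbound n d hn Θ' hmar hadm).1
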